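/- Let $k$ be a field of characteristic zero, let $n\ge 12$, and let $\mathfrak g$ be a filiform Lie algebra of dimension $n$ over $k$, i.e. for the lower central series $\mathfrak g^0=\mathfrak g$, $\mathfrak g^{m}=[\mathfrak g,\mathfrak g^{m-1}]$ one has $\mathfrak g^{n-1}=0$ and $\mathfrak g^{n-2}\ne 0$. Assume that the law of $\mathfrak g$ lies in $\mathcal A_n^1$, which means: (a) there is no subspace $U\supseteq \mathfrak g^1$ of codimension one with $[U,\mathfrak g^1]\subseteq \mathfrak g^4$; (b) if $n$ is even, then $\mathfrak g^{(n-4)/2}$ is abelian; (c) $[\mathfrak g^1,\mathfrak g^1]\subseteq \mathfrak g^6$. Let $(e_1,\dots,e_n)$ be an adapted basis of $\mathfrak g$ with structure constants $\alpha_{k,s}$, i.e. $[e_1,e_i]=e_{i+1}$ for $2\le i\le n-1$, $[e_1,e_n]=0$, and for $2\le i<j\le n$ $$[e_i,e_j]=\sum_{r=1}^n\Bigl(\sum_{\ell=0}^{\lfloor (j-i-1)/2\rfloor}(-1)^\ell\binom{j-i-\ell-1}{\ell}\alpha_{i+\ell,\,r-j+i+2\ell+1}\Bigr)e_r ,$$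 where $\alpha_{k,s}=0$ unless $2\le k\le \lfloor n/2\rfloor$ and $2k+1\le s\le n$, or $n$ is even and $(k,s)=(n/2,n)$. Assume that the basis is normalized so that $\alpha_{2,5}=1$. (In terms of the structure constants, (a), (b), (c) say $\alpha_{2,5}\neq0$, $\alpha_{n/2,n}=0$ if $n$ is even, and $\alpha_{3,7}=0$.) A linear map $P:\mathfrak g\to\mathfrak g$ is a prederivation if $P([x,[y,z]])=[P(x),[y,z]]+[x,[P(y),z]]+[x,[y,P(z)]]$ for all $x,y,z\in\mathfrak g$. Then $\mathfrak g$ admits a non-singular (i.e. bijective) prederivation if and only if $$\alpha_{3,i}=0\quad (i=8,\dots,n),\qquad \alpha_{2,j}=\frac{1}{2^{j-5}(j-3)}\binom{2j-8}{j-4}\,\alpha_{2,6}^{\,j-5}\quad (j=7,\dots,n-1).$$ Moreover, $\mathfrak g$ admits a non-singular derivation if and only if, in addition to these conditions, $$\alpha_{2,n}=\frac{1}{2^{n-5}(n-3)}\binom{2n-8}{n-4}\,\alpha_{2,6}^{\,n-5}.$$ -/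

import Mathlib

/-- A linear map `P` is a prederivation of the Lie algebra `L` if
`P [x,[y,z]] = [P x,[y,z]] + [x,[P y,z]] + [x,[y,P z]]` for all `x, y, z`. -/
def IsPrederivation {K L : Type*} [Field K] [LieRing L] [LieAlgebra K L]
    (P : L →ₗ[K] L) : Prop :=
  ∀ x y z : L, P ⁅x, ⁅y, z⁆⁆ = ⁅P x, ⁅y, z⁆⁆ + ⁅x, ⁅P y, z⁆⁆ + ⁅x, ⁅y, P z⁆⁆

/-- The lower central series `𝔤⁰ = 𝔤`, `𝔤ᵏ = [𝔤, 𝔤ᵏ⁻¹]`. -/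
abbrev lcsTerm (K L : Type*) [Field K] [LieRing L] [LieAlgebra K L] (k : ℕ) : LieIdeal K L :=
  LieModule.lowerCentralSeries K L L k

/-- `L` is filiform of dimension `n`: it is nilpotent of the maximal possible nilpotency
class `n - 1`, that is, `𝔤ⁿ⁻¹ = 0` and `𝔤ⁿ⁻² ≠ 0`. -/
structure IsFiliform (K L : Type*) [Field K] [LieRing L] [LieAlgebra K L] (n : ℕ) : Prop where
  finite : Module.Finite K L
  two_le : 2 ≤ n
  finrank_eq : Module.finrank K L = n
  lcs_eq_bot : lcsTerm K L (n - 1) = ⊥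
  lcs_ne_bot : lcsTerm K L (n - 2) ≠ ⊥

/-- Property (a): there is no subspace `U ⊇ 𝔤¹` of codimension one with `[U, 𝔤¹] ⊆ 𝔤⁴`. -/
def PropertyA (K L : Type*) [Field K] [LieRing L] [LieAlgebra K L] : Prop :=
  ¬ ∃ U : Submodule K L, Module.finrank K (L ⧸ U) = 1 ∧
      (lcsTerm K L 1).toSubmodule ≤ U ∧
      ∀ x ∈ U, ∀ y ∈ lcsTerm K L 1, ⁅x, y⁆ ∈ lcsTerm K L 4

/-- Property (b): if `n` is even, then `𝔤^((n-4)/2)` is abelian. -/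
def PropertyB (K L : Type*) [Field K] [LieRing L] [LieAlgebra K L] (n : ℕ) : Prop :=
  Even n → ∀ x ∈ lcsTerm K L ((n - 4) / 2), ∀ y ∈ lcsTerm K L ((n - 4) / 2), ⁅x, y⁆ = 0

/-- Property (c): `[𝔤¹, 𝔤¹] ⊆ 𝔤⁶`. -/
def PropertyC (K L : Type*) [Field K] [LieRing L] [LieAlgebra K L] : Prop :=
  ∀ x ∈ lcsTerm K L 1, ∀ y ∈ lcsTerm K L 1, ⁅x, y⁆ ∈ lcsTerm K L 6

/-- The Lie algebra `L` has its law in the class `𝒜ₙ¹`: it is filiform of dimension `n` and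
has the properties (a), (b) and (c). -/
structure InClassA1 (K L : Type*) [Field K] [LieRing L] [LieAlgebra K L] (n : ℕ) : Prop where
  filiform : IsFiliform K L n
  propA : PropertyA K L
  propB : PropertyB K L n
  propC : PropertyC K L

/-- The index set `ℐₙ`: pairs `(k, s)` with `2 ≤ k ≤ ⌊n/2⌋` and `2k + 1 ≤ s ≤ n`, together with
`(n/2, n)` if `n` is even. -/
def filiformIndexSet (n : ℕ) : Set (ℕ × ℕ) :=
  {p | 2 ≤ p.1 ∧ p.1 ≤ n / 2 ∧ 2 * p.1 + 1 ≤ p.2 ∧ p.2 ≤ n} ∪ {p | Even n ∧ p = (n / 2, n)}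

/-- The vectors of a basis, numbered `e₁, …, eₙ` (and zero for other numbers). -/
noncomputable def basisVec {K L : Type*} [Field K] [LieRing L] [LieAlgebra K L] {n : ℕ}
    (e : Module.Basis (Fin n) K L) (i : ℕ) : L :=
  if h : 1 ≤ i ∧ i ≤ n then e ⟨i - 1, by omega⟩ else 0

/-- `e` is an adapted basis of the `n`-dimensional filiform Lie algebra `L`, with structure
constants `α k s` vanishing outside `ℐₙ`: the brackets are
`[e₁, eᵢ] = eᵢ₊₁` for `2 ≤ i ≤ n - 1`, `[e₁, eₙ] = 0`, and for `2 ≤ i < j ≤ n`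
`[eᵢ, eⱼ] = ∑ᵣ (∑_ℓ (-1)^ℓ binom(j-i-ℓ-1, ℓ) α_{i+ℓ, r-j+i+2ℓ+1}) eᵣ`.
(Where the second index `r - j + i + 2ℓ + 1` is negative, the truncated subtraction gives `0`,
and in both readings the index is outside `ℐₙ`.) -/
structure IsAdaptedBasis {K L : Type*} [Field K] [LieRing L] [LieAlgebra K L] {n : ℕ}
    (e : Module.Basis (Fin n) K L) (α : ℕ → ℕ → K) : Prop where
  support : ∀ k s : ℕ, (k, s) ∉ filiformIndexSet n → α k s = 0
  lie_one : ∀ i : ℕ, 2 ≤ i → i ≤ n - 1 → ⁅basisVec e 1, basisVec e i⁆ = basisVec e (i + 1)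
  lie_one_last : ⁅basisVec e 1, basisVec e n⁆ = 0
  lie_lie : ∀ i j : ℕ, 2 ≤ i → i < j → j ≤ n →
    ⁅basisVec e i, basisVec e j⁆ =
      ∑ r ∈ Finset.Icc 1 n,
        (∑ l ∈ Finset.range ((j - i - 1) / 2 + 1),
          (-1 : K) ^ l * ((j - i - l - 1).choose l : K) * α (i + l) (r + i + 2 * l + 1 - j)) •
          basisVec e r

/-! Filter `L` by the spans of e_m, e_{m+1}, …. A few instances of the prederivation identity force
P to be triangular with diagonal a, 2a, 3a, …; if P is non-singular then a ≠ 0, and one rescales to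
a = 1. Now there are eigenvectors x_j = e_j + ⋯ of weight j, weights add in double brackets
[x,[y,z]], and a vector of weight j lying at a level beyond j is zero. A bracket of weight 7 at
level 8 kills [e₃,e₄] degree by degree, and the Jacobi identity spreads this: e₃, …, e_n commute
(`HasWeights.lie_eq_zero`).

Hence ⟨e₃, …, e_n⟩ is K[X]/(X^(n-2)), where e₁ acts as X and e₂ as f = ∑ α_{2,m+3} X^m; x₁ acts as t
= X + c f and x₂ as f. For a derivation, comparing vectors of weight 5 gives f ≡ t² mod X^(n-2). For
a prederivation [x₁,x₂] need not have weight 3; relations of weights 5 and 6 must be combined, at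
the cost of one power of X. This is why α_{2,n} stays free. The equation f = (X + c f)² is solved by
a Catalan series with 2c = α_{2,6}, which gives the binomial formula.

Conversely, f ≡ t² makes e₁ ↦ e₁ - c e₂, e₂ ↦ 2 e₂, p ↦ 3p + (X - c f) p' a derivation. If the
congruence holds only mod X^(n-3), the defect is a multiple κ X^(n-3), absorbed by changing the
images of e₃ and e₅; the result is a prederivation. -/

section AdaptedFamily

/-! ### The filtration by basis tails, and when e₃, …, e_n commute. -/

variable {K L : Type*} [Field K] [LieRing L] [LieAlgebra K L]

/-- The span of the vectors `E r` with `m ≤ r`. -/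
def tailSpan (K : Type*) {L : Type*} [Field K] [LieRing L] [LieAlgebra K L]
    (E : ℕ → L) (m : ℕ) : Submodule K L :=
  Submodule.span K (E '' Set.Ici m)

/-- The properties of the vectors of an adapted basis of a filiform Lie algebra that refer to the
filtration by the tails of the basis. -/
structure FilteredFamily (K : Type*) {L : Type*} [Field K] [LieRing L] [LieAlgebra K L]
    (n : ℕ) (E : ℕ → L) : Prop where
  eq_zero : ∀ i, n < i → E i = 0
  tail_one : tailSpan K E 1 = ⊤
  lead : ∀ (m : ℕ) (a : K), 1 ≤ m → m ≤ n → a • E m ∈ tailSpan K E (m + 1) → a = 0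
  lie_one : ∀ i, 2 ≤ i → ⁅E 1, E i⁆ = E (i + 1)
  lie_mem : ∀ i j, 2 ≤ i → 2 ≤ j → ⁅E i, E j⁆ ∈ tailSpan K E (i + j)

/-- A filtered family with the leading terms of `[e₂, e₃]` and `[e₃, e₄]` that occur in the class
`𝒜ₙ¹`. -/
structure AdaptedFamily (K : Type*) {L : Type*} [Field K] [LieRing L] [LieAlgebra K L]
    (n : ℕ) (E : ℕ → L) : Prop extends FilteredFamily K n E where
  lie_two_three : ⁅E 2, E 3⁆ - E 5 ∈ tailSpan K E 6
  lie_three_four : ⁅E 3, E 4⁆ ∈ tailSpan K E 8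

theorem mem_tailSpan (E : ℕ → L) {m r : ℕ} (h : m ≤ r) : E r ∈ tailSpan K E m :=
  Submodule.subset_span ⟨r, h, rfl⟩

theorem tailSpan_anti (E : ℕ → L) {m r : ℕ} (h : m ≤ r) : tailSpan K E r ≤ tailSpan K E m :=
  Submodule.span_mono (Set.image_mono (Set.Ici_subset_Ici.2 h))

theorem tailSpan_le {E : ℕ → L} {m : ℕ} {S : Submodule K L} (h : ∀ r, m ≤ r → E r ∈ S) :
    tailSpan K E m ≤ S := by
  refine Submodule.span_le.2 ?_
  rintro _ ⟨r, hr, rfl⟩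
  exact h r hr

theorem tailSpan_split (E : ℕ → L) {m : ℕ} {x : L} (hx : x ∈ tailSpan K E m) :
    ∃ a : K, x - a • E m ∈ tailSpan K E (m + 1) := by
  have : tailSpan K E m ≤ Submodule.span K {E m} ⊔ tailSpan K E (m + 1) := by
    refine tailSpan_le fun r hr => ?_
    rcases hr.eq_or_lt with rfl | hr
    · exact Submodule.mem_sup_left (Submodule.mem_span_singleton_self _)
    · exact Submodule.mem_sup_right (mem_tailSpan E hr)
  obtain ⟨y, hy, w, hw, rfl⟩ := Submodule.mem_sup.1 (this hx)
  obtain ⟨a, rfl⟩ := Submodule.mem_span_singleton.1 hy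
  exact ⟨a, by simpa using hw⟩

theorem lie_mem_of_tailSpan {E : ℕ → L} {i j : ℕ} {S : Submodule K L}
    (h : ∀ a b, i ≤ a → j ≤ b → ⁅E a, E b⁆ ∈ S) {x y : L}
    (hx : x ∈ tailSpan K E i) (hy : y ∈ tailSpan K E j) : ⁅x, y⁆ ∈ S := by
  have h1 : ∀ a, i ≤ a → ⁅E a, y⁆ ∈ S := fun a ha =>
    (tailSpan_le (S := S.comap (LieModule.toEnd K L L (E a))) fun r hr => h a r ha hr) hy
  have h2 := (tailSpan_le (S := S.comap (LieModule.toEnd K L L y)) (E := E) (m := i) fun r hr => by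
    have := S.neg_mem (h1 r hr)
    rwa [lie_skew] at this) hx
  have := S.neg_mem h2
  simpa using this

namespace FilteredFamily

variable {n : ℕ} {E : ℕ → L}

theorem tail_eq_bot (hE : FilteredFamily K n E) {m : ℕ} (hm : n < m) : tailSpan K E m = ⊥ :=
  le_bot_iff.1 (tailSpan_le fun r hr => by simp [hE.eq_zero r (by omega)])

theorem mem_one (hE : FilteredFamily K n E) (x : L) : x ∈ tailSpan K E 1 := by
  simp [hE.tail_one]

theorem lie_tail (hE : FilteredFamily K n E) {i j k : ℕ} (hi : 2 ≤ i) (hj : 2 ≤ j) (hk : k ≤ i + j)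
    {x y : L} (hx : x ∈ tailSpan K E i) (hy : y ∈ tailSpan K E j) : ⁅x, y⁆ ∈ tailSpan K E k :=
  lie_mem_of_tailSpan (fun a b ha hb =>
    tailSpan_anti E (by omega) (hE.lie_mem a b (by omega) (by omega))) hx hy

theorem lie_any (hE : FilteredFamily K n E) {j k : ℕ} (hj : 2 ≤ j) (hk : k ≤ j + 1)
    (x : L) {y : L} (hy : y ∈ tailSpan K E j) : ⁅x, y⁆ ∈ tailSpan K E k :=
  lie_mem_of_tailSpan (fun a b ha hb => by
    rcases ha.eq_or_lt with rfl | ha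
    · rw [hE.lie_one b (by omega)]
      exact mem_tailSpan E (by omega)
    · exact tailSpan_anti E (by omega) (hE.lie_mem a b (by omega) (by omega))) (hE.mem_one x) hy

theorem any_lie (hE : FilteredFamily K n E) {j k : ℕ} (hj : 2 ≤ j) (hk : k ≤ j + 1)
    {x : L} (hx : x ∈ tailSpan K E j) (y : L) : ⁅x, y⁆ ∈ tailSpan K E k := by
  rw [← lie_skew]
  exact Submodule.neg_mem _ (hE.lie_any hj hk y hx)

theorem lie_mem_three (hE : FilteredFamily K n E) (x y : L) : ⁅x, y⁆ ∈ tailSpan K E 3 :=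
  lie_mem_of_tailSpan (fun a b ha hb => by
    rcases ha.eq_or_lt with rfl | ha
    · rcases hb.eq_or_lt with rfl | hb
      · simp
      · exact hE.lie_any hb (by omega) _ (mem_tailSpan E le_rfl)
    · exact hE.any_lie ha (by omega) (mem_tailSpan E le_rfl) _) (hE.mem_one x) (hE.mem_one y)

end FilteredFamily

namespace AdaptedFamily

variable {n : ℕ} {E : ℕ → L}

/-- If brackets of basis vectors beyond `e₂` raise the degree by `d` (up to the total degree `k`),
then `[e₂, eⱼ] = eⱼ₊₂` up to higher terms. -/
theorem lie_two_sub_mem_of (hE : AdaptedFamily K n E) {k : ℕ}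
    (h : ∀ j, 3 ≤ j → j < k → ⁅E 3, E j⁆ ∈ tailSpan K E (j + 4)) :
    ∀ j, 3 ≤ j → j ≤ k → ⁅E 2, E j⁆ - E (j + 2) ∈ tailSpan K E (j + 3) := by
  intro j hj
  induction j, hj using Nat.le_induction with
  | base => exact fun _ => hE.lie_two_three
  | succ j hj ih =>
    intro hjk
    -- Jacobi for e_{j+1} = [e₁,e_j]; the hypothesis puts the extra term [e₃,e_j] one level above
    -- the generic one.
    have e1 : ⁅E 2, E (j + 1)⁆ - E (j + 1 + 2) =
        ⁅E 1, ⁅E 2, E j⁆ - E (j + 2)⁆ - ⁅E 3, E j⁆ := by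
      rw [lie_sub, leibniz_lie, hE.lie_one 2 le_rfl, hE.lie_one j (by omega),
        hE.lie_one (j + 2) (by omega)]
      abel_nf
    rw [e1]
    exact Submodule.sub_mem _ (hE.lie_any (by omega) le_rfl _ (ih (by omega)))
      (h j hj (by omega))

/-- Applying ad e₁ to [e_i,e_j] shows that brackets of equal total degree agree up to sign modulo
the next level, so one small bracket per total degree suffices: [e_k,e_k] for even degree, [e₃,e₄]
for degree 7, and an argument with ad e₂ for larger odd degree. -/
theorem lie_mem_succ [CharZero K] (hE : AdaptedFamily K n E) {d : ℕ}
    (h : ∀ i j, 3 ≤ i → 3 ≤ j → ⁅E i, E j⁆ ∈ tailSpan K E (i + j + d))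
    (h34 : ⁅E 3, E 4⁆ ∈ tailSpan K E (8 + d)) :
    ∀ m i j, 3 ≤ i → 3 ≤ j → i + j = m → ⁅E i, E j⁆ ∈ tailSpan K E (i + j + d + 1) := by
  intro m
  induction m using Nat.strong_induction_on with
  | _ m ih =>
  have step : ∀ i j, 3 ≤ i → 3 ≤ j → i + j + 1 = m →
      ⁅E (i + 1), E j⁆ + ⁅E i, E (j + 1)⁆ ∈ tailSpan K E (m + d + 1) := by
    intro i j hi hj hm
    rw [← hE.lie_one i (by omega), ← hE.lie_one j (by omega), ← leibniz_lie]
    exact hE.lie_any (by omega) (by omega) _ (ih (i + j) (by omega) i j hi hj rfl)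
  have spread : ∀ i₀ j₀, 3 ≤ i₀ → 3 ≤ j₀ → i₀ + j₀ = m →
      ⁅E i₀, E j₀⁆ ∈ tailSpan K E (m + d + 1) →
      ∀ i j, 3 ≤ i → 3 ≤ j → i + j = m → ⁅E i, E j⁆ ∈ tailSpan K E (m + d + 1) := by
    intro i₀ j₀ hi₀ hj₀ hm h0
    have up : ∀ t i j, 3 ≤ i → 3 ≤ j → i + j = m → i = i₀ + t →
        ⁅E i, E j⁆ ∈ tailSpan K E (m + d + 1) := by
      intro t
      induction t with
      | zero =>
        intro i j _ _ hij hi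
        obtain rfl : i = i₀ := by omega
        obtain rfl : j = j₀ := by omega
        exact h0
      | succ t iht =>
        intro i j hi3 hj hij hi
        obtain ⟨i, rfl⟩ : ∃ i', i = i' + 1 := ⟨i - 1, by omega⟩
        exact (Submodule.add_mem_iff_left _
          (iht i (j + 1) (by omega) (by omega) (by omega) (by omega))).1
          (step i j (by omega) hj (by omega))
    have down : ∀ t i j, 3 ≤ i → 3 ≤ j → i + j = m → i₀ = i + t →
        ⁅E i, E j⁆ ∈ tailSpan K E (m + d + 1) := by
      intro t
      induction t with
      | zero =>
        intro i j _ _ hij hi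
        obtain rfl : i = i₀ := by omega
        obtain rfl : j = j₀ := by omega
        exact h0
      | succ t iht =>
        intro i j hi3 hj hij hi
        obtain ⟨j, rfl⟩ : ∃ j', j = j' + 1 := ⟨j - 1, by omega⟩
        exact (Submodule.add_mem_iff_right _
          (iht (i + 1) j (by omega) (by omega) (by omega) (by omega))).1
          (step i j (by omega) (by omega) (by omega))
    intro i j hi hj hij
    rcases le_total i₀ i with hle | hle
    · exact up (i - i₀) i j hi hj hij (by omega)
    · exact down (i₀ - i) i j hi hj hij (by omega)
  have key : 6 ≤ m → ∃ i j, 3 ≤ i ∧ 3 ≤ j ∧ i + j = m ∧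
      ⁅E i, E j⁆ ∈ tailSpan K E (m + d + 1) := by
    intro hm
    rcases Nat.even_or_odd' m with ⟨k, rfl | rfl⟩
    · exact ⟨k, k, by omega, by omega, by omega, by simp⟩
    obtain rfl | hk : k = 3 ∨ 4 ≤ k := by omega
    · exact ⟨3, 4, by omega, by omega, by omega, tailSpan_anti E (by omega) h34⟩
    refine ⟨k, k + 1, by omega, by omega, by omega, ?_⟩
    obtain ⟨l, rfl⟩ : ∃ l, k = l + 1 := ⟨k - 1, by omega⟩
    have h2 := hE.lie_two_sub_mem_of (k := l + 1) fun j hj hjl =>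
      tailSpan_anti E (by omega) (ih (3 + j) (by omega) 3 j le_rfl hj rfl)
    have hB : ∀ {i j : ℕ} {x y : L}, 3 ≤ i → 3 ≤ j → i + j = 2 * (l + 1) + 1 + 1 →
        x ∈ tailSpan K E i → y ∈ tailSpan K E j → ⁅x, y⁆ ∈ tailSpan K E (2 * (l + 1) + 1 + d + 1) :=
      fun hi hj hij hx hy => lie_mem_of_tailSpan (fun a b ha hb =>
        tailSpan_anti E (by omega) (h a b (by omega) (by omega))) hx hy
    have m1 : ⁅E 2, ⁅E l, E (l + 1)⁆⁆ ∈ tailSpan K E (2 * (l + 1) + 1 + d + 1) :=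
      hE.lie_tail le_rfl (j := 2 * (l + 1) + d) (by omega) (by omega) (mem_tailSpan E le_rfl)
        (tailSpan_anti E (by omega) (ih (l + (l + 1)) (by omega) l (l + 1) (by omega) (by omega) rfl))
    have m2 := hB (by omega) (by omega) (by omega) (h2 l (by omega) (by omega))
      (mem_tailSpan E (le_refl (l + 1)))
    have m3 := hB (by omega) (by omega) (by omega) (mem_tailSpan E (le_refl l))
      (h2 (l + 1) (by omega) le_rfl)
    have m4 := step l (l + 2) (by omega) (by omega) (by omega)
    -- Up to higher terms ad e₂ shifts each argument of [e_l,e_{l+1}] by two, giving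
    -- [e_{l+2},e_{l+1}] + [e_l,e_{l+3}]; by `step` both summands are -[e_{l+1},e_{l+2}].
    have e1 : (2 : K) • ⁅E (l + 1), E (l + 2)⁆ =
        ⁅⁅E 2, E l⁆ - E (l + 2), E (l + 1)⁆ + ⁅E l, ⁅E 2, E (l + 1)⁆ - E (l + 1 + 2)⁆
        + (⁅E (l + 1), E (l + 2)⁆ + ⁅E l, E (l + 2 + 1)⁆) - ⁅E 2, ⁅E l, E (l + 1)⁆⁆ := by
      rw [sub_lie, lie_sub, leibniz_lie (E 2), ← lie_skew (E (l + 2)) (E (l + 1)), two_smul,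
        show l + 2 + 1 = l + 1 + 2 by omega]
      abel
    have m5 : (2 : K) • ⁅E (l + 1), E (l + 2)⁆ ∈ tailSpan K E (2 * (l + 1) + 1 + d + 1) := by
      rw [e1]
      exact Submodule.sub_mem _ (Submodule.add_mem _ (Submodule.add_mem _ m2 m3) m4) m1
    exact (Submodule.smul_mem_iff _ two_ne_zero).1 m5
  intro i j hi hj hij
  obtain ⟨i₀, j₀, hi₀, hj₀, hm, h0⟩ := key (by omega)
  rw [hij]
  exact spread i₀ j₀ hi₀ hj₀ hm h0 i j hi hj hij

/-- If the component of `[e₃, e₄]` of each degree vanishes as soon as all brackets of lower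
degree do, then `e₃, …, eₙ` commute. -/
theorem lie_eq_zero_of [CharZero K] (hE : AdaptedFamily K n E)
    (h : ∀ d, 1 ≤ d → (∀ i j, 3 ≤ i → 3 ≤ j → ⁅E i, E j⁆ ∈ tailSpan K E (i + j + d)) →
      ⁅E 3, E 4⁆ ∈ tailSpan K E (8 + d))
    {x y : L} (hx : x ∈ tailSpan K E 3) (hy : y ∈ tailSpan K E 3) : ⁅x, y⁆ = 0 := by
  have all : ∀ d i j, 3 ≤ i → 3 ≤ j → ⁅E i, E j⁆ ∈ tailSpan K E (i + j + d) := by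
    intro d
    induction d with
    | zero => exact fun i j hi hj => hE.lie_mem i j (by omega) (by omega)
    | succ d ih =>
      refine fun i j hi hj => hE.lie_mem_succ ih ?_ (i + j) i j hi hj rfl
      rcases d.eq_zero_or_pos with rfl | hd
      · exact hE.lie_three_four
      · exact h d hd ih
  rw [← Submodule.mem_bot K, ← hE.tail_eq_bot (Nat.lt_succ_self n)]
  exact lie_mem_of_tailSpan (fun a b ha hb => tailSpan_anti E (by omega) (all (n + 1) a b ha hb))
    hx hy

end AdaptedFamily

end AdaptedFamily

/-! ### Prederivations are triangular with proportional weights; homogeneous vectors. -/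

section Weights

variable {K L : Type*} [Field K] [LieRing L] [LieAlgebra K L]

/-- `P` acts on the filtration by the tails of `E` with weights `1, 2, 3, …`. -/
def HasWeights (P : L →ₗ[K] L) (E : ℕ → L) : Prop :=
  ∀ j : ℕ, 1 ≤ j → P (E j) - (j : K) • E j ∈ tailSpan K E (j + 1)

theorem IsPrederivation.smul {P : L →ₗ[K] L} (hP : IsPrederivation P) (a : K) :
    IsPrederivation (a • P) := fun x y z => by
  simp [hP x y z]

theorem LieDerivation.isPrederivation (D : LieDerivation K L L) :
    IsPrederivation (D : L →ₗ[K] L) := fun x y z => by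
  simp only [LieDerivation.coeFn_coe, LieDerivation.apply_lie_eq_add, lie_add]
  abel

namespace AdaptedFamily

variable {n : ℕ} {E : ℕ → L} {P : L →ₗ[K] L}

theorem eq_zero_of_smul_add_smul (hE : AdaptedFamily K n E) {m : ℕ} (hm : 1 ≤ m) (hmn : m + 1 ≤ n)
    {a b : K} (h : a • E m + b • E (m + 1) ∈ tailSpan K E (m + 2)) : a = 0 ∧ b = 0 := by
  have ha : a = 0 := by
    refine hE.lead m a hm (by omega) ((Submodule.add_mem_iff_left _ ?_).1
      (tailSpan_anti E (Nat.le_succ _) h))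
    exact Submodule.smul_mem _ _ (mem_tailSpan E le_rfl)
  subst ha
  exact ⟨rfl, hE.lead (m + 1) b (by omega) hmn (by simpa using h)⟩

/-- In the identity at (e₃,e₁,e₂) the left side is P[e₃,e₃] = 0, and the unwanted coefficients of P
e₃ appear on the right as the leading coefficients at e₄ and e₅. -/
theorem prederivation_three_mem (hE : AdaptedFamily K n E) (hn : 12 ≤ n) (hP : IsPrederivation P) :
    P (E 3) ∈ tailSpan K E 3 := by
  obtain ⟨r₁, h₁⟩ := tailSpan_split E (hE.mem_one (P (E 3)))
  obtain ⟨r₂, h₂⟩ := tailSpan_split E h₁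
  set y := P (E 3) - r₁ • E 1 - r₂ • E 2 with hy
  have hP3 : P (E 3) = r₁ • E 1 + r₂ • E 2 + y := by rw [hy]; abel
  have h := hP (E 3) (E 1) (E 2)
  rw [hE.lie_one 2 le_rfl, lie_self, map_zero, hP3, add_lie, add_lie, smul_lie, smul_lie,
    hE.lie_one 3 (by omega)] at h
  have m1 : ⁅y, E 3⁆ ∈ tailSpan K E 6 :=
    hE.lie_tail (by omega) (by omega) (by omega) h₂ (mem_tailSpan E le_rfl)
  have m2 : ⁅E 3, ⁅P (E 1), E 2⁆⁆ ∈ tailSpan K E 6 :=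
    hE.lie_tail (by omega) (by omega) (by omega) (mem_tailSpan E le_rfl) (hE.lie_mem_three _ _)
  have m3 : ⁅E 3, ⁅E 1, P (E 2)⁆⁆ ∈ tailSpan K E 6 :=
    hE.lie_tail (by omega) (by omega) (by omega) (mem_tailSpan E le_rfl) (hE.lie_mem_three _ _)
  have m4 := Submodule.smul_mem _ r₂ hE.lie_two_three
  have e : r₁ • E 4 + r₂ • E 5 = -(r₂ • (⁅E 2, E 3⁆ - E 5) + ⁅y, E 3⁆ + ⁅E 3, ⁅P (E 1), E 2⁆⁆ +
      ⁅E 3, ⁅E 1, P (E 2)⁆⁆) := by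
    rw [eq_neg_iff_add_eq_zero, smul_sub]
    refine Eq.trans ?_ h.symm
    abel
  obtain ⟨rfl, rfl⟩ := hE.eq_zero_of_smul_add_smul (m := 4) (by omega) (by omega) (a := r₁) (b := r₂)
    (by rw [e]; exact Submodule.neg_mem _ (Submodule.add_mem _ (Submodule.add_mem _
      (Submodule.add_mem _ m4 m1) m2) m3))
  rw [hP3]
  simpa using h₂

theorem prederivation_mem (hE : AdaptedFamily K n E) (hn : 12 ≤ n) (hP : IsPrederivation P) :
    ∀ j, 3 ≤ j → P (E j) ∈ tailSpan K E j := by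
  have step : ∀ j, 3 ≤ j → P (E j) ∈ tailSpan K E j → P (E (j + 2)) ∈ tailSpan K E (j + 2) := by
    intro j hj h
    rw [← hE.lie_one (j + 1) (by omega), ← hE.lie_one j (by omega), hP]
    have h0 := mem_tailSpan (K := K) E (le_refl j)
    have hc : ∀ (a b : L) {c : L}, c ∈ tailSpan K E j → ⁅a, ⁅b, c⁆⁆ ∈ tailSpan K E (j + 2) :=
      fun a b c hc => hE.lie_any (j := j + 1) (by omega) le_rfl _ (hE.lie_any (by omega) le_rfl _ hc)
    exact Submodule.add_mem _ (Submodule.add_mem _ (hc _ _ h0) (hc _ _ h0)) (hc _ _ h)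
  have h3 := hE.prederivation_three_mem hn hP
  have h4 : P (E 4) ∈ tailSpan K E 4 := by
    rw [← hE.lie_one 3 (by omega), ← hE.lie_one 2 le_rfl, hP]
    have hc : ∀ a b c : L, ⁅a, ⁅b, c⁆⁆ ∈ tailSpan K E 4 := fun a b c =>
      hE.lie_any (j := 3) (by omega) le_rfl _ (hE.lie_mem_three _ _)
    exact Submodule.add_mem _ (Submodule.add_mem _ (hc _ _ _) (hc _ _ _)) (hc _ _ _)
  intro j
  induction j using Nat.strong_induction_on with
  | _ j ih =>
    intro hj
    obtain rfl | rfl | hj : j = 3 ∨ j = 4 ∨ 5 ≤ j := by omega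
    · exact h3
    · exact h4
    · obtain ⟨i, rfl⟩ : ∃ i, j = i + 2 := ⟨j - 2, by omega⟩
      exact step i (by omega) (ih i (by omega) (by omega))

theorem prederivation_tail (hE : AdaptedFamily K n E) (hn : 12 ≤ n) (hP : IsPrederivation P)
    {m : ℕ} (hm : 3 ≤ m) {x : L} (hx : x ∈ tailSpan K E m) : P x ∈ tailSpan K E m :=
  (tailSpan_le (S := (tailSpan K E m).comap P) fun r hr =>
    tailSpan_anti E hr (hE.prederivation_mem hn hP r (by omega))) hx

/-- In the identity at (e₂,e₂,e₃) an e₁-component q of P e₂ contributes q e₆ through two of the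
terms, while everything else lies at level 7; so 2q = 0. -/
theorem prederivation_two_mem [CharZero K] (hE : AdaptedFamily K n E) (hn : 12 ≤ n)
    (hP : IsPrederivation P) : P (E 2) ∈ tailSpan K E 2 := by
  obtain ⟨q, hq⟩ := tailSpan_split E (hE.mem_one (P (E 2)))
  set y := P (E 2) - q • E 1 with hy
  have hP2 : P (E 2) = q • E 1 + y := by rw [hy]; abel
  set w := ⁅E 2, E 3⁆ - E 5 with hw
  have h23 : ⁅E 2, E 3⁆ = E 5 + w := by rw [hw]; abel
  have hw6 : w ∈ tailSpan K E 6 := hE.lie_two_three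
  have hE2 := mem_tailSpan (K := K) E (le_refl 2)
  have hE3 := mem_tailSpan (K := K) E (le_refl 3)
  have h := hP (E 2) (E 2) (E 3)
  have m0 : P ⁅E 2, ⁅E 2, E 3⁆⁆ ∈ tailSpan K E 7 := by
    refine hE.prederivation_tail hn hP (by omega) ?_
    exact hE.lie_tail (j := 5) (by omega) (by omega) (by omega) hE2
      (hE.lie_tail (by omega) (by omega) (by omega) hE2 hE3)
  have m3 : ⁅E 2, ⁅E 2, P (E 3)⁆⁆ ∈ tailSpan K E 7 :=
    hE.lie_tail (j := 5) (by omega) (by omega) (by omega) hE2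
      (hE.lie_tail (by omega) (by omega) (by omega) hE2 (hE.prederivation_three_mem hn hP))
  have m2 : ⁅E 2, ⁅y, E 3⁆⁆ ∈ tailSpan K E 7 :=
    hE.lie_tail (j := 5) (by omega) (by omega) (by omega) hE2
      (hE.lie_tail (by omega) (by omega) (by omega) hq hE3)
  have m1 : ⁅y, ⁅E 2, E 3⁆⁆ ∈ tailSpan K E 7 :=
    hE.lie_tail (j := 5) (by omega) (by omega) (by omega) hq
      (hE.lie_tail (by omega) (by omega) (by omega) hE2 hE3)
  have m4 : ⁅E 1, w⁆ ∈ tailSpan K E 7 := hE.lie_any (by omega) le_rfl _ hw6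
  have m5 : ⁅E 2, E 4⁆ - E 6 ∈ tailSpan K E 7 :=
    hE.lie_two_sub_mem_of (k := 4) (fun j hj hj' => by
      obtain rfl : j = 3 := by omega
      simp) 4 (by omega) le_rfl
  have e : (2 * q) • E 6 = P ⁅E 2, ⁅E 2, E 3⁆⁆ - ⁅E 2, ⁅E 2, P (E 3)⁆⁆ - ⁅E 2, ⁅y, E 3⁆⁆
      - ⁅y, ⁅E 2, E 3⁆⁆ - q • ⁅E 1, w⁆ - q • (⁅E 2, E 4⁆ - E 6) := by
    rw [h, hP2, add_lie, add_lie, lie_add, smul_lie, smul_lie, lie_smul, hE.lie_one 3 (by omega)]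
    conv_rhs => rw [h23]
    rw [lie_add (E 1), hE.lie_one 5 (by omega), smul_add, smul_sub, two_mul, add_smul]
    abel
  have hq0 : 2 * q = 0 := hE.lead 6 _ (by omega) (by omega) (by
    rw [e]
    exact Submodule.sub_mem _ (Submodule.sub_mem _ (Submodule.sub_mem _ (Submodule.sub_mem _
      (Submodule.sub_mem _ m0 m3) m2) m1) (Submodule.smul_mem _ _ m4)) (Submodule.smul_mem _ _ m5))
  obtain rfl : q = 0 := by simpa using hq0
  rw [hP2]
  simpa using hq

theorem prederivation_weight_step (hE : AdaptedFamily K n E) (hP : IsPrederivation P) {a : K}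
    (ha : P (E 1) - a • E 1 ∈ tailSpan K E 2) {j : ℕ} (hj : 2 ≤ j) {b : K}
    (hb : P (E j) - b • E j ∈ tailSpan K E (j + 1)) :
    P (E (j + 2)) - (2 * a + b) • E (j + 2) ∈ tailSpan K E (j + 2 + 1) := by
  set x := P (E 1) - a • E 1 with hx
  set y := P (E j) - b • E j with hy
  have h1 : P (E 1) = a • E 1 + x := by rw [hx]; abel
  have h2 : P (E j) = b • E j + y := by rw [hy]; abel
  have h := hP (E 1) (E 1) (E j)
  rw [hE.lie_one j hj, hE.lie_one (j + 1) (by omega), h1, h2] at h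
  simp only [add_lie, lie_add, smul_lie, lie_smul, hE.lie_one j hj,
    hE.lie_one (j + 1) (by omega)] at h
  have m1 : ⁅x, E (j + 1)⁆ ∈ tailSpan K E (j + 2 + 1) :=
    hE.lie_tail le_rfl (by omega) (by omega) ha (mem_tailSpan E le_rfl)
  have m2 : ⁅E 1, ⁅x, E j⁆⁆ ∈ tailSpan K E (j + 2 + 1) :=
    hE.lie_any (j := j + 2) (by omega) le_rfl _
      (hE.lie_tail le_rfl hj (by omega) ha (mem_tailSpan E le_rfl))
  have m3 : ⁅E 1, ⁅E 1, y⁆⁆ ∈ tailSpan K E (j + 2 + 1) :=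
    hE.lie_any (j := j + 2) (by omega) le_rfl _ (hE.lie_any (by omega) le_rfl _ hb)
  have e : P (E (j + 2)) - (2 * a + b) • E (j + 2) =
      ⁅x, E (j + 1)⁆ + ⁅E 1, ⁅x, E j⁆⁆ + ⁅E 1, ⁅E 1, y⁆⁆ := by
    rw [h, add_smul, two_mul, add_smul]
    abel
  rw [e]
  exact Submodule.add_mem _ (Submodule.add_mem _ m1 m2) m3

/-- Let a, b, c be the diagonal entries at e₁, e₂, e₃. Since e_{j+2} = [e₁,[e₁,e_j]], the entries at
e₅ and e₆ are 2a + c and 4a + b. Reading e₆ also from [e₁,[e₂,e₃]] gives a + b + c, and e₅ from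
[e₂,[e₁,e₂]] gives a + 2b; hence c = 3a and b = 2a. -/
theorem prederivation_weights [CharZero K] (hE : AdaptedFamily K n E) (hn : 12 ≤ n)
    (hP : IsPrederivation P) :
    ∃ a : K, ∀ j : ℕ, 1 ≤ j → P (E j) - (a * j) • E j ∈ tailSpan K E (j + 1) := by
  obtain ⟨a, ha⟩ := tailSpan_split E (hE.mem_one (P (E 1)))
  obtain ⟨b, hb⟩ := tailSpan_split E (hE.prederivation_two_mem hn hP)
  obtain ⟨c, hc⟩ := tailSpan_split E (hE.prederivation_three_mem hn hP)
  have h5 := hE.prederivation_weight_step hP ha (by omega) hc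
  have h6 := hE.prederivation_weight_step hP ha (by omega)
    (hE.prederivation_weight_step hP ha le_rfl hb)
  set x := P (E 1) - a • E 1 with hx
  set y := P (E 2) - b • E 2 with hy
  set z := P (E 3) - c • E 3 with hz
  set w := ⁅E 2, E 3⁆ - E 5 with hw
  have h1 : P (E 1) = a • E 1 + x := by rw [hx]; abel
  have h2 : P (E 2) = b • E 2 + y := by rw [hy]; abel
  have h3 : P (E 3) = c • E 3 + z := by rw [hz]; abel
  have h23 : ⁅E 2, E 3⁆ = E 5 + w := by rw [hw]; abel
  have hw6 : w ∈ tailSpan K E 6 := hE.lie_two_three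
  have hE2 := mem_tailSpan (K := K) E (le_refl 2)
  have hE3 := mem_tailSpan (K := K) E (le_refl 3)
  have hc3 : c = 3 * a := by
    have h := hP (E 1) (E 2) (E 3)
    rw [h23, lie_add, hE.lie_one 5 (by omega), h1, h2, h3] at h
    simp only [add_lie, lie_add, smul_lie, lie_smul, h23, hE.lie_one 5 (by omega), map_add,
      smul_add] at h
    have m0 : P ⁅E 1, w⁆ ∈ tailSpan K E 7 :=
      hE.prederivation_tail hn hP (by omega) (hE.lie_any (by omega) le_rfl _ hw6)
    have m1 : ⁅E 1, w⁆ ∈ tailSpan K E 7 := hE.lie_any (by omega) le_rfl _ hw6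
    have m2 : ⁅x, E 5⁆ ∈ tailSpan K E 7 :=
      hE.lie_tail le_rfl (by omega) (by omega) ha (mem_tailSpan E le_rfl)
    have m3 : ⁅x, w⁆ ∈ tailSpan K E 7 := hE.lie_tail le_rfl (by omega) (by omega) ha hw6
    have m4 : ⁅E 1, ⁅y, E 3⁆⁆ ∈ tailSpan K E 7 :=
      hE.lie_any (j := 6) (by omega) le_rfl _ (hE.lie_tail (by omega) (by omega) (by omega) hb hE3)
    have m5 : ⁅E 1, ⁅E 2, z⁆⁆ ∈ tailSpan K E 7 :=
      hE.lie_any (j := 6) (by omega) le_rfl _ (hE.lie_tail (by omega) (by omega) (by omega) hE2 hc)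
    have e : (c - 3 * a) • E 6 = (P (E 6) - (2 * a + (2 * a + b)) • E 6) + P ⁅E 1, w⁆
        - a • ⁅E 1, w⁆ - ⁅x, E 5⁆ - ⁅x, w⁆ - b • ⁅E 1, w⁆ - ⁅E 1, ⁅y, E 3⁆⁆ - c • ⁅E 1, w⁆
        - ⁅E 1, ⁅E 2, z⁆⁆ := by
      have h' := eq_sub_of_add_eq h
      rw [h']
      module
    refine sub_eq_zero.1 (hE.lead 6 _ (by omega) (by omega) ?_)
    rw [e]
    exact Submodule.sub_mem _ (Submodule.sub_mem _ (Submodule.sub_mem _ (Submodule.sub_mem _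
      (Submodule.sub_mem _ (Submodule.sub_mem _ (Submodule.sub_mem _ (Submodule.add_mem _ h6 m0)
      (Submodule.smul_mem _ _ m1)) m2) m3) (Submodule.smul_mem _ _ m1)) m4)
      (Submodule.smul_mem _ _ m1)) m5
  have hb2 : b = 2 * a := by
    have h := hP (E 2) (E 1) (E 2)
    rw [hE.lie_one 2 le_rfl, h23, h1, h2] at h
    simp only [add_lie, lie_add, smul_lie, lie_smul, h23, hE.lie_one 2 le_rfl, map_add,
      smul_add] at h
    have m0 : P w ∈ tailSpan K E 6 := hE.prederivation_tail hn hP (by omega) hw6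
    have m1 : ⁅y, E 3⁆ ∈ tailSpan K E 6 := hE.lie_tail (by omega) (by omega) (by omega) hb hE3
    have m2 : ⁅E 2, ⁅x, E 2⁆⁆ ∈ tailSpan K E 6 :=
      hE.lie_tail (j := 4) le_rfl (by omega) (by omega) hE2
        (hE.lie_tail (by omega) (by omega) (by omega) ha hE2)
    have m3 : ⁅E 2, ⁅E 1, y⁆⁆ ∈ tailSpan K E 6 :=
      hE.lie_tail (j := 4) le_rfl (by omega) (by omega) hE2 (hE.lie_any (by omega) le_rfl _ hb)
    have e : (2 * (b - 2 * a)) • E 5 = (P (E 5) - (2 * a + c) • E 5) + P w - b • w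
        - ⁅y, E 3⁆ - a • w - ⁅E 2, ⁅x, E 2⁆⁆ - b • w - ⁅E 2, ⁅E 1, y⁆⁆ := by
      have h' := eq_sub_of_add_eq h
      rw [h', hc3]
      module
    have h0 : 2 * (b - 2 * a) = 0 := hE.lead 5 _ (by omega) (by omega) (by
      rw [e]
      exact Submodule.sub_mem _ (Submodule.sub_mem _ (Submodule.sub_mem _ (Submodule.sub_mem _
        (Submodule.sub_mem _ (Submodule.sub_mem _ (Submodule.add_mem _ h5 m0)
        (Submodule.smul_mem _ _ hw6)) m1) (Submodule.smul_mem _ _ hw6)) m2)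
        (Submodule.smul_mem _ _ hw6)) m3)
    exact sub_eq_zero.1 (by simpa using h0)
  refine ⟨a, fun j => ?_⟩
  induction j using Nat.strong_induction_on with
  | _ j ih =>
    intro hj
    obtain rfl | rfl | rfl | hj : j = 1 ∨ j = 2 ∨ j = 3 ∨ 4 ≤ j := by omega
    · simpa [hx] using ha
    · rw [mul_comm a]; push_cast; rw [← hb2]; exact hb
    · rw [mul_comm a]; push_cast; rw [← hc3]; exact hc
    · obtain ⟨i, rfl⟩ : ∃ i, j = i + 2 := ⟨j - 2, by omega⟩
      have := hE.prederivation_weight_step hP ha (by omega) (ih i (by omega) (by omega))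
      have e : 2 * a + a * (i : K) = a * ((i + 2 : ℕ) : K) := by push_cast; ring
      rwa [e] at this

theorem exists_hasWeights [CharZero K] (hE : AdaptedFamily K n E) (hn : 12 ≤ n)
    (hP : IsPrederivation P) (hinj : Function.Injective P) :
    ∃ a : K, HasWeights (a • P) E := by
  obtain ⟨a, ha⟩ := hE.prederivation_weights hn hP
  have ha0 : a ≠ 0 := by
    rintro rfl
    have h := ha n (by omega)
    rw [hE.tail_eq_bot (Nat.lt_succ_self n), Submodule.mem_bot, zero_mul, zero_smul, sub_zero,
      ← map_zero P] at h
    have h0 := hinj h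
    exact one_ne_zero (hE.lead n (1 : K) (by omega) le_rfl (by simp [h0]))
  refine ⟨a⁻¹, fun j hj => ?_⟩
  have := Submodule.smul_mem _ a⁻¹ (ha j hj)
  rwa [smul_sub, smul_smul, inv_mul_cancel_left₀ ha0] at this

end AdaptedFamily

namespace HasWeights

variable {n : ℕ} {E : ℕ → L} {P : L →ₗ[K] L}

theorem map_tail (hw : HasWeights P E) {m : ℕ} (hm : 1 ≤ m) {x : L}
    (hx : x ∈ tailSpan K E m) : P x ∈ tailSpan K E m := by
  refine (tailSpan_le (S := (tailSpan K E m).comap P) fun r hr => ?_) hx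
  have h1 := tailSpan_anti E (by omega : m ≤ r + 1) (hw r (by omega))
  exact (Submodule.sub_mem_iff_left _ (Submodule.smul_mem _ _ (mem_tailSpan E hr))).1 h1

theorem map_sub_mem (hw : HasWeights P E) {m : ℕ} (hm : 1 ≤ m) {x : L}
    (hx : x ∈ tailSpan K E m) : P x - (m : K) • x ∈ tailSpan K E (m + 1) := by
  obtain ⟨a, ha⟩ := tailSpan_split E hx
  have e : P x - (m : K) • x = a • (P (E m) - (m : K) • E m) + (P (x - a • E m) -
      (m : K) • (x - a • E m)) := by
    rw [map_sub, map_smul]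
    module
  rw [e]
  exact Submodule.add_mem _ (Submodule.smul_mem _ _ (hw m hm))
    (Submodule.sub_mem _ (hw.map_tail (by omega) ha) (Submodule.smul_mem _ _ ha))

/-- P acts as the scalar m on level m modulo level m + 1, and m ≠ j, so x sinks through all levels.
-/
theorem eq_zero_of_mem [CharZero K] (hE : AdaptedFamily K n E) (hw : HasWeights P E) {j m : ℕ}
    (hjm : j < m) {x : L} (hx : x ∈ tailSpan K E m) (hPx : P x = (j : K) • x) : x = 0 := by
  have all : ∀ r, x ∈ tailSpan K E (m + r) := by
    intro r
    induction r with
    | zero => exact hx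
    | succ r ih =>
      have h := hw.map_sub_mem (by omega) ih
      rw [hPx, ← sub_smul] at h
      refine (Submodule.smul_mem_iff _ (sub_ne_zero.2 ?_)).1 h
      exact_mod_cast (by omega : j ≠ m + r)
  have h := all (n + 1)
  rwa [hE.tail_eq_bot (by omega), Submodule.mem_bot] at h

/-- P - j is surjective on every level beyond j, so e_j can be corrected by higher terms; `solve`
proceeds from the zero level n + 1 + j upwards. -/
theorem exists_eigenvector [CharZero K] (hE : AdaptedFamily K n E) (hw : HasWeights P E) {j : ℕ}
    (hj : 1 ≤ j) : ∃ x, x - E j ∈ tailSpan K E (j + 1) ∧ P x = (j : K) • x := by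
  have solve : ∀ r m, j < m → m + r = n + 1 + j → ∀ y ∈ tailSpan K E m,
      ∃ x ∈ tailSpan K E m, P x - (j : K) • x = y := by
    intro r
    induction r with
    | zero =>
      intro m _ hm y hy
      rw [hE.tail_eq_bot (by omega), Submodule.mem_bot] at hy
      exact ⟨0, Submodule.zero_mem _, by simp [hy]⟩
    | succ r ih =>
      intro m hjm hm y hy
      have hne : (m : K) - j ≠ 0 := sub_ne_zero.2 (by exact_mod_cast (by omega : m ≠ j))
      have h1 : y - (P (((m : K) - j)⁻¹ • y) - (j : K) • (((m : K) - j)⁻¹ • y)) ∈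
          tailSpan K E (m + 1) := by
        have := Submodule.smul_mem _ (-((m : K) - j)⁻¹) (hw.map_sub_mem (by omega) hy)
        convert this using 1
        rw [map_smul, smul_sub, neg_smul, smul_smul, smul_smul]
        have e : (1 : K) = ((m : K) - j)⁻¹ * m - ((m : K) - j)⁻¹ * j := by
          rw [← mul_sub, inv_mul_cancel₀ hne]
        nth_rewrite 1 [← one_smul K y]
        rw [e]
        module
      obtain ⟨x, hx, hPx⟩ := ih (m + 1) (by omega) (by omega) _ h1
      refine ⟨((m : K) - j)⁻¹ • y + x, Submodule.add_mem _ (Submodule.smul_mem _ _ hy)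
        (tailSpan_anti E (Nat.le_succ m) hx), ?_⟩
      rw [map_add, smul_add, add_sub_add_comm, hPx]
      abel
  by_cases hjn : n < j
  · exact ⟨0, by simp [hE.eq_zero j hjn], by simp⟩
  obtain ⟨x, hx, hPx⟩ := solve n (j + 1) (by omega) (by omega) _ (hw j hj)
  refine ⟨E j - x, by simpa using hx, ?_⟩
  rw [map_sub, smul_sub, sub_eq_sub_iff_sub_eq_sub]
  exact hPx.symm

theorem pre_lie [CharZero K] (hP : IsPrederivation P) {a b c : ℕ} {x y z : L}
    (hx : P x = (a : K) • x) (hy : P y = (b : K) • y) (hz : P z = (c : K) • z) :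
    P ⁅x, ⁅y, z⁆⁆ = ((a + b + c : ℕ) : K) • ⁅x, ⁅y, z⁆⁆ := by
  rw [hP, hx, hy, hz, smul_lie, smul_lie, lie_smul, lie_smul, lie_smul]
  push_cast
  module

/-- A graded prederivation forces `e₃, …, eₙ` to commute. -/
theorem lie_eq_zero [CharZero K] (hE : AdaptedFamily K n E) (hw : HasWeights P E)
    (hP : IsPrederivation P) {x y : L} (hx : x ∈ tailSpan K E 3) (hy : y ∈ tailSpan K E 3) :
    ⁅x, y⁆ = 0 := by
  refine hE.lie_eq_zero_of (fun d hd h => ?_) hx hy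
  obtain ⟨x₁, hx₁, hP₁⟩ := hw.exists_eigenvector hE le_rfl
  obtain ⟨x₂, hx₂, hP₂⟩ := hw.exists_eigenvector hE (j := 2) (by omega)
  have hB : ∀ {i j : ℕ} {x y : L}, 3 ≤ i → 3 ≤ j → 8 ≤ i + j →
      x ∈ tailSpan K E i → y ∈ tailSpan K E j → ⁅x, y⁆ ∈ tailSpan K E (8 + d) :=
    fun hi hj hij hx hy => lie_mem_of_tailSpan (fun a b ha hb =>
      tailSpan_anti E (by omega) (h a b (by omega) (by omega))) hx hy
  have hx₂' : x₂ ∈ tailSpan K E 2 := (Submodule.sub_mem_iff_left _ (mem_tailSpan E le_rfl)).1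
    (tailSpan_anti E (by omega : 2 ≤ 3) hx₂)
  have hz : ⁅x₁, x₂⁆ - E 3 ∈ tailSpan K E 4 := by
    have e : ⁅x₁, x₂⁆ - E 3 = ⁅x₁ - E 1, x₂⁆ + ⁅E 1, x₂ - E 2⁆ := by
      rw [sub_lie, lie_sub, hE.lie_one 2 le_rfl]; abel
    rw [e]
    exact Submodule.add_mem _ (hE.lie_tail le_rfl le_rfl (by omega) hx₁ hx₂')
      (hE.lie_any (by omega) le_rfl _ hx₂)
  have hz' : ⁅x₁, x₂⁆ ∈ tailSpan K E 3 := hE.lie_mem_three _ _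
  have h4 : ⁅x₁, ⁅x₁, x₂⁆⁆ - E 4 ∈ tailSpan K E 5 := by
    have e : ⁅x₁, ⁅x₁, x₂⁆⁆ - E 4 = ⁅x₁ - E 1, ⁅x₁, x₂⁆⁆ + ⁅E 1, ⁅x₁, x₂⁆ - E 3⁆ := by
      rw [sub_lie, lie_sub, hE.lie_one 3 (by omega)]; abel
    rw [e]
    exact Submodule.add_mem _ (hE.lie_tail le_rfl (by omega) (by omega) hx₁ hz')
      (hE.lie_any (by omega) le_rfl _ hz)
  have h4P : P ⁅x₁, ⁅x₁, x₂⁆⁆ = ((4 : ℕ) : K) • ⁅x₁, ⁅x₁, x₂⁆⁆ := pre_lie hP hP₁ hP₁ hP₂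
  -- Although [x₁,x₂] need not be homogeneous, this is a double bracket of vectors of weights 4, 1,
  -- 2. It is -[e₃,e₄] plus terms at level 8 + d and lies at level 8, so it vanishes.
  have h7P : P ⁅⁅x₁, ⁅x₁, x₂⁆⁆, ⁅x₁, x₂⁆⁆ = ((7 : ℕ) : K) • ⁅⁅x₁, ⁅x₁, x₂⁆⁆, ⁅x₁, x₂⁆⁆ :=
    pre_lie hP h4P hP₁ hP₂
  have e : ⁅⁅x₁, ⁅x₁, x₂⁆⁆, ⁅x₁, x₂⁆⁆ = -⁅E 3, E 4⁆ + (⁅⁅x₁, ⁅x₁, x₂⁆⁆ - E 4, ⁅x₁, x₂⁆⁆ +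
      ⁅E 4, ⁅x₁, x₂⁆ - E 3⁆) := by
    rw [sub_lie, lie_sub, lie_skew]; abel
  have m1 := hB (by omega) (by omega) (by omega) h4 hz'
  have m2 := hB (by omega) (by omega) (by omega) (mem_tailSpan E (le_refl 4)) hz
  have m3 : ⁅⁅x₁, ⁅x₁, x₂⁆⁆, ⁅x₁, x₂⁆⁆ ∈ tailSpan K E 8 := by
    rw [e]
    exact Submodule.add_mem _ (Submodule.neg_mem _ hE.lie_three_four)
      (tailSpan_anti E (by omega) (Submodule.add_mem _ m1 m2))
  rw [hw.eq_zero_of_mem hE (by omega) m3 h7P] at e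
  have e2 : ⁅E 3, E 4⁆ = ⁅⁅x₁, ⁅x₁, x₂⁆⁆ - E 4, ⁅x₁, x₂⁆⁆ + ⁅E 4, ⁅x₁, x₂⁆ - E 3⁆ := by
    rw [eq_comm, neg_add_eq_zero] at e
    exact e
  rw [e2]
  exact Submodule.add_mem _ m1 m2

end HasWeights

end Weights

/-! ### The commuting part as a truncated polynomial ring; necessity of f ≡ (X + c f)². -/

section Polynomials

open Polynomial

variable {K L : Type*} [Field K] [LieRing L] [LieAlgebra K L]

/-- The linear map `p ↦ p(ad e₁) e₃`. -/
noncomputable def polyMap (K : Type*) {L : Type*} [Field K] [LieRing L] [LieAlgebra K L]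
    (E : ℕ → L) : K[X] →ₗ[K] L :=
  (LinearMap.applyₗ (E 3)).comp (aeval (LieModule.toEnd K L L (E 1))).toLinearMap

theorem polyMap_apply (E : ℕ → L) (p : K[X]) :
    polyMap K E p = aeval (LieModule.toEnd K L L (E 1)) p (E 3) := rfl

theorem polyMap_one (E : ℕ → L) : polyMap K E 1 = E 3 := by
  simp [polyMap_apply]

theorem polyMap_X_mul (E : ℕ → L) (p : K[X]) :
    polyMap K E (X * p) = ⁅E 1, polyMap K E p⁆ := by
  simp [polyMap_apply]

namespace AdaptedFamily

variable {n : ℕ} {E : ℕ → L}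

theorem polyMap_X_pow (hE : AdaptedFamily K n E) (k : ℕ) : polyMap K E (X ^ k) = E (k + 3) := by
  induction k with
  | zero => simp [polyMap_one]
  | succ k ih => rw [pow_succ', polyMap_X_mul, ih, hE.lie_one _ (by omega)]

theorem exists_polyMap_eq (hE : AdaptedFamily K n E) {x : L} (hx : x ∈ tailSpan K E 3) :
    ∃ p, polyMap K E p = x :=
  (tailSpan_le (S := LinearMap.range (polyMap K E)) fun r hr =>
    ⟨X ^ (r - 3), by rw [hE.polyMap_X_pow, Nat.sub_add_cancel hr]⟩) hx

theorem polyMap_mem (hE : AdaptedFamily K n E) {k : ℕ} {p : K[X]} (h : X ^ k ∣ p) :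
    polyMap K E p ∈ tailSpan K E (k + 3) := by
  obtain ⟨q, rfl⟩ := h
  induction q using Polynomial.induction_on' with
  | add p q hp hq => rw [mul_add, map_add]; exact Submodule.add_mem _ hp hq
  | monomial m a =>
    rw [X_pow_mul_monomial, ← mul_one a, ← smul_eq_mul, ← smul_monomial, monomial_one_right_eq_X_pow,
      map_smul, hE.polyMap_X_pow]
    exact Submodule.smul_mem _ _ (mem_tailSpan E (by omega))

theorem dvd_of_polyMap_mem (hE : AdaptedFamily K n E) {k : ℕ} (hk : k + 2 ≤ n) {p : K[X]}
    (h : polyMap K E p ∈ tailSpan K E (k + 3)) : X ^ k ∣ p := by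
  have all : ∀ r, r ≤ k → X ^ r ∣ p := by
    intro r
    induction r with
    | zero => simp
    | succ r ih =>
      intro hr
      obtain ⟨q, rfl⟩ := ih (by omega)
      have e : X ^ r * q = q.coeff 0 • X ^ r + X ^ (r + 1) * q.divX := by
        conv_lhs => rw [← q.X_mul_divX_add]
        rw [smul_eq_C_mul]
        ring
      rw [e, map_add, map_smul, hE.polyMap_X_pow] at h
      have h1 := (Submodule.add_mem_iff_left _ (tailSpan_anti E (by omega : r + 3 + 1 ≤ r + 1 + 3)
        (hE.polyMap_mem (dvd_mul_right _ _)))).1 (tailSpan_anti E (by omega : r + 3 + 1 ≤ k + 3) h)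
      rw [e, hE.lead (r + 3) _ (by omega) (by omega) h1]
      simp
  exact all k le_rfl

/-- This identifies ⟨e₃, …, e_n⟩ with K[X]/(X^(n-2)); X^k corresponds to e_{k+3}. -/
theorem polyMap_eq_zero_iff (hE : AdaptedFamily K n E) (hn : 2 ≤ n) {p : K[X]} :
    polyMap K E p = 0 ↔ X ^ (n - 2) ∣ p := by
  have hb : tailSpan K E (n - 2 + 3) = ⊥ := hE.tail_eq_bot (by omega)
  constructor
  · intro h
    exact hE.dvd_of_polyMap_mem (by omega) (by rw [h]; exact Submodule.zero_mem _)
  · intro h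
    simpa [hb] using hE.polyMap_mem h

theorem polyMap_tail (hE : AdaptedFamily K n E) (p : K[X]) : polyMap K E p ∈ tailSpan K E 3 :=
  hE.polyMap_mem (k := 0) (by simp)

/-- On the commuting span ad e₂ commutes with ad e₁, because [e₁,e₂] = e₃ acts by zero there. So ad
e₂ is K[X]-linear and determined by its value on e₃. -/
theorem lie_two_polyMap (hE : AdaptedFamily K n E)
    (hc : ∀ x ∈ tailSpan K E 3, ∀ y ∈ tailSpan K E 3, ⁅x, y⁆ = 0) {f : K[X]}
    (hf : ⁅E 2, E 3⁆ = polyMap K E f) (p : K[X]) :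
    ⁅E 2, polyMap K E p⁆ = polyMap K E (f * p) := by
  have hX : ∀ k : ℕ, ⁅E 2, polyMap K E (X ^ k)⁆ = polyMap K E (f * X ^ k) := by
    intro k
    induction k with
    | zero => simpa [polyMap_one] using hf
    | succ k ih =>
      rw [pow_succ', polyMap_X_mul, leibniz_lie, ih, ← lie_skew (E 2) (E 1), hE.lie_one 2 le_rfl, neg_lie,
        hc _ (mem_tailSpan E le_rfl) _ (hE.polyMap_tail _), ← polyMap_X_mul, neg_zero, zero_add,
        mul_left_comm]
  induction p using Polynomial.induction_on' with
  | add p q hp hq => rw [map_add, lie_add, hp, hq, mul_add, map_add]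
  | monomial m a =>
    rw [← mul_one a, ← smul_eq_mul, ← smul_monomial, monomial_one_right_eq_X_pow, map_smul,
      lie_smul, hX, mul_smul_comm, map_smul]

/-- The multiplications by which eigenvectors of weights 1 and 2 act on `⟨e₃, …, eₙ⟩`. -/
theorem lie_eigenvectors_polyMap (hE : AdaptedFamily K n E) (hn : 3 ≤ n)
    (hc : ∀ x ∈ tailSpan K E 3, ∀ y ∈ tailSpan K E 3, ⁅x, y⁆ = 0) {f : K[X]}
    (hf : ⁅E 2, E 3⁆ = polyMap K E f) {x₁ x₂ : L} (hx₁ : x₁ - E 1 ∈ tailSpan K E 2)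
    (hx₂ : x₂ - E 2 ∈ tailSpan K E 3) :
    (∃ c : K, ∀ p, ⁅x₁, polyMap K E p⁆ = polyMap K E ((X + C c * f) * p)) ∧
      (∀ p, ⁅x₂, polyMap K E p⁆ = polyMap K E (f * p)) ∧
      ∃ u, ⁅x₁, x₂⁆ = polyMap K E u ∧ X ∣ u - 1 := by
  refine ⟨?_, ?_, ?_⟩
  · obtain ⟨c, hc1⟩ := tailSpan_split E hx₁
    refine ⟨c, fun p => ?_⟩
    have e : x₁ = E 1 + c • E 2 + (x₁ - E 1 - c • E 2) := by abel
    rw [e, add_lie, add_lie, hc _ hc1 _ (hE.polyMap_tail p), smul_lie, hE.lie_two_polyMap hc hf,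
      ← polyMap_X_mul, ← map_smul, add_zero, ← map_add, smul_eq_C_mul]
    congr 1
    ring
  · intro p
    have e : x₂ = E 2 + (x₂ - E 2) := by abel
    rw [e, add_lie, hc _ hx₂ _ (hE.polyMap_tail p), hE.lie_two_polyMap hc hf, add_zero]
  · obtain ⟨u, hu⟩ := hE.exists_polyMap_eq (hE.lie_mem_three x₁ x₂)
    refine ⟨u, hu.symm, ?_⟩
    have hx₂' : x₂ ∈ tailSpan K E 2 := (Submodule.sub_mem_iff_left _ (mem_tailSpan E le_rfl)).1
      (tailSpan_anti E (by omega : 2 ≤ 3) hx₂)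
    have e : polyMap K E (u - 1) = ⁅x₁ - E 1, x₂⁆ + ⁅E 1, x₂ - E 2⁆ := by
      rw [map_sub, hu, polyMap_one, sub_lie, lie_sub, hE.lie_one 2 le_rfl]; abel
    rw [← pow_one X]
    refine hE.dvd_of_polyMap_mem (k := 1) (by omega) ?_
    rw [e]
    exact Submodule.add_mem _ (hE.lie_tail le_rfl le_rfl (by omega) hx₁ hx₂')
      (hE.lie_any (by omega) le_rfl _ hx₂)

end AdaptedFamily

/-- Both products have leading term X², so vectors of weight 5 represented by them differ by
something at level 6. -/
theorem X_pow_three_dvd_mul_sub {c : K} {f u v : K[X]} (hf : X ^ 3 ∣ f - X ^ 2)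
    (hu : X ∣ u - 1) (hv : X ∣ v - 1) : X ^ 3 ∣ f * u - (X + C c * f) ^ 2 * v := by
  obtain ⟨g, hg⟩ := hf
  obtain ⟨u', hu⟩ := hu
  obtain ⟨v', hv⟩ := hv
  obtain rfl := eq_add_of_sub_eq hg
  obtain rfl := eq_add_of_sub_eq hu
  obtain rfl := eq_add_of_sub_eq hv
  refine ⟨g * (X * u' + 1) + u' - v' - (2 * C c * (X * g + 1) + C c ^ 2 * X * (X * g + 1) ^ 2) *
    (X * v' + 1), ?_⟩
  ring

namespace HasWeights

variable {n : ℕ} {E : ℕ → L} {P : L →ₗ[K] L}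

theorem exists_dvd_of_prederivation [CharZero K] (hE : AdaptedFamily K n E) (hn : 12 ≤ n)
    (hw : HasWeights P E) (hP : IsPrederivation P) {f : K[X]} (hf : ⁅E 2, E 3⁆ = polyMap K E f)
    (hf2 : X ^ 3 ∣ f - X ^ 2) : ∃ c : K, X ^ (n - 3) ∣ f - (X + C c * f) ^ 2 := by
  have hc : ∀ x ∈ tailSpan K E 3, ∀ y ∈ tailSpan K E 3, ⁅x, y⁆ = 0 := fun x hx y hy =>
    hw.lie_eq_zero hE hP hx hy
  obtain ⟨x₁, hx₁, hP₁⟩ := hw.exists_eigenvector hE le_rfl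
  obtain ⟨x₂, hx₂, hP₂⟩ := hw.exists_eigenvector hE (j := 2) (by omega)
  obtain ⟨x₃, hx₃, hP₃⟩ := hw.exists_eigenvector hE (j := 3) (by omega)
  obtain ⟨⟨c, h₁⟩, h₂, u, hu, hu1⟩ := hE.lie_eigenvectors_polyMap (by omega) hc hf hx₁ hx₂
  obtain ⟨v, rfl⟩ := hE.exists_polyMap_eq ((Submodule.sub_mem_iff_left _
    (mem_tailSpan E le_rfl)).1 (tailSpan_anti E (by omega : 3 ≤ 4) hx₃))
  have hv1 : X ∣ v - 1 := by
    rw [← pow_one X]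
    refine hE.dvd_of_polyMap_mem (k := 1) (by omega) ?_
    rwa [map_sub, polyMap_one]
  refine ⟨c, ?_⟩
  set t : K[X] := X + C c * f with ht
  have hPz := pre_lie hP hP₁ hP₁ hP₂
  -- The vectors [x₂,[x₁,x₂]] and [x₁,[x₁,x₃]] both have weight 5.
  have h5 : X ^ (n - 2) ∣ f * u - t ^ 2 * v := by
    have a := pre_lie hP hP₂ hP₁ hP₂
    have b := pre_lie hP hP₁ hP₁ hP₃
    rw [hu, h₂] at a
    rw [h₁, h₁] at b
    rw [← hE.polyMap_eq_zero_iff (by omega)]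
    refine hw.eq_zero_of_mem hE (j := 5) (by omega)
      (hE.polyMap_mem (X_pow_three_dvd_mul_sub (c := c) hf2 hu1 hv1)) ?_
    rw [sq, mul_assoc, map_sub, map_sub, a, b, smul_sub]
  -- The vectors [x₁,[x₂,x₃]] and [x₁,[x₁,[x₁,[x₁,x₂]]]] both have weight 6.
  have h6 : X ^ (n - 2) ∣ t * (f * v - t ^ 2 * u) := by
    have a := pre_lie hP hP₁ hP₂ hP₃
    have b := pre_lie hP hP₁ hP₁ hPz
    rw [h₂, h₁] at a
    rw [hu, h₁, h₁, h₁] at b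
    rw [← hE.polyMap_eq_zero_iff (by omega)]
    refine hw.eq_zero_of_mem hE (j := 6) (m := 3 + 1 + 3) (by omega) (hE.polyMap_mem ?_) ?_
    · rw [pow_succ' X 3]
      refine mul_dvd_mul ?_ (X_pow_three_dvd_mul_sub (c := c) hf2 hv1 hu1)
      obtain ⟨g, hg⟩ := hf2
      rw [ht, eq_add_of_sub_eq hg]
      exact ⟨1 + C c * (X ^ 2 * g + X), by ring⟩
    · rw [mul_sub, sq, mul_assoc t t u, map_sub, map_sub, a, b, smul_sub]
  obtain ⟨g, hg⟩ := hf2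
  obtain ⟨s, hs, hs0⟩ : ∃ s, t = X * s ∧ X ∣ s - 1 := by
    rw [ht, eq_add_of_sub_eq hg]
    exact ⟨1 + C c * (X ^ 2 * g + X), by ring, C c * (X * g + 1), by ring⟩
  -- Adding t times the first relation to the second gives t (f - t²)(u + v). Here u + v has
  -- constant term 2, and t = X s with s(0) = 1 costs exactly one power of X.
  have h7 : X * X ^ (n - 3) ∣ X * ((f - t ^ 2) * (s * (u + v))) := by
    rw [← pow_succ', show n - 3 + 1 = n - 2 by omega]
    have := dvd_add (dvd_mul_of_dvd_right h5 t) h6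
    convert this using 1
    calc X * ((f - t ^ 2) * (s * (u + v))) = (X * s) * ((f - t ^ 2) * (u + v)) := by ring
      _ = _ := by rw [← hs]; ring
  refine prime_X.pow_dvd_of_dvd_mul_right _ ?_ ((mul_dvd_mul_iff_left X_ne_zero).1 h7)
  rw [X_dvd_iff] at hs0 hu1 hv1 ⊢
  rw [coeff_sub, sub_eq_zero] at hs0 hu1 hv1
  rw [mul_coeff_zero, coeff_add, hs0, hu1, hv1]
  norm_num

/-- For a derivation [x₁,x₂] itself has weight 3 and can play the role of x₃. The relation of weight
5 becomes (f - t²) u ≡ 0 with u(0) = 1, and no power is lost. -/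
theorem exists_dvd_of_derivation [CharZero K] (hE : AdaptedFamily K n E) (hn : 12 ≤ n)
    {D : LieDerivation K L L} {a : K} (hw : HasWeights (a • (D : L →ₗ[K] L)) E) {f : K[X]}
    (hf : ⁅E 2, E 3⁆ = polyMap K E f)
    (hf2 : X ^ 3 ∣ f - X ^ 2) : ∃ c : K, X ^ (n - 2) ∣ f - (X + C c * f) ^ 2 := by
  have hP := D.isPrederivation.smul a
  have hD : ∀ x y, (a • (D : L →ₗ[K] L)) ⁅x, y⁆ =
      ⁅(a • (D : L →ₗ[K] L)) x, y⁆ + ⁅x, (a • (D : L →ₗ[K] L)) y⁆ := fun x y => by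
    simp only [LinearMap.smul_apply, LieDerivation.coeFn_coe, LieDerivation.apply_lie_eq_add,
      smul_add, smul_lie, lie_smul]
    abel
  set P := a • (D : L →ₗ[K] L)
  have hc : ∀ x ∈ tailSpan K E 3, ∀ y ∈ tailSpan K E 3, ⁅x, y⁆ = 0 := fun x hx y hy =>
    hw.lie_eq_zero hE hP hx hy
  obtain ⟨x₁, hx₁, hP₁⟩ := hw.exists_eigenvector hE le_rfl
  obtain ⟨x₂, hx₂, hP₂⟩ := hw.exists_eigenvector hE (j := 2) (by omega)
  obtain ⟨⟨c, h₁⟩, h₂, u, hu, hu1⟩ := hE.lie_eigenvectors_polyMap (by omega) hc hf hx₁ hx₂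
  have hP₃ : P ⁅x₁, x₂⁆ = ((3 : ℕ) : K) • ⁅x₁, x₂⁆ := by
    rw [hD, hP₁, hP₂, smul_lie, lie_smul]
    push_cast
    module
  refine ⟨c, ?_⟩
  set t : K[X] := X + C c * f with ht
  have h5 : X ^ (n - 2) ∣ f * u - t ^ 2 * u := by
    have a := pre_lie hP hP₂ hP₁ hP₂
    have b := pre_lie hP hP₁ hP₁ hP₃
    rw [hu, h₂] at a
    rw [hu, h₁, h₁] at b
    rw [← hE.polyMap_eq_zero_iff (by omega)]
    refine hw.eq_zero_of_mem hE (j := 5) (by omega)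
      (hE.polyMap_mem (X_pow_three_dvd_mul_sub (c := c) hf2 hu1 hu1)) ?_
    rw [sq, mul_assoc, map_sub, map_sub, a, b, smul_sub]
  rw [← sub_mul] at h5
  refine prime_X.pow_dvd_of_dvd_mul_right _ ?_ h5
  rw [X_dvd_iff] at hu1 ⊢
  rw [coeff_sub, sub_eq_zero] at hu1
  rw [hu1]
  norm_num

end HasWeights

end Polynomials

/-! ### Constructing the derivation and the prederivation. -/

section Construction

open Polynomial

variable {K L : Type*} [Field K] [LieRing L] [LieAlgebra K L]

/-- If `f` is the square of `τ = X + c f` modulo `X ^ N`, then it is an eigenvector of the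
derivation `τ (d / dτ) = (X - c f) (d / dX)`, again modulo `X ^ N`. -/
theorem X_pow_dvd_mul_derivative_sub {c : K} {f : K[X]} {N : ℕ} (hf : X ^ 2 ∣ f)
    (h : X ^ N ∣ f - (X + C c * f) ^ 2) :
    X ^ N ∣ (X - C c * f) * derivative f - 2 * f := by
  rcases N.eq_zero_or_pos with rfl | hN
  · simp
  obtain ⟨g, hg⟩ := h
  obtain ⟨φ, hφ⟩ := hf
  have hd := congrArg derivative hg
  rw [derivative_mul, derivative_sub, derivative_sq, derivative_add, derivative_X, derivative_C_mul,
    derivative_X_pow] at hd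
  have hX : (X : K[X]) ^ N = X * X ^ (N - 1) := by rw [← pow_succ', Nat.sub_add_cancel hN]
  -- Differentiating f - τ² = X^N g gives (1 - 2cτ) f' = 2τ + (X^N g)', and 1 - 2cτ is 1 at X = 0.
  -- The factor X - c f is divisible by X, which restores the power lost in (X^N g)'.
  refine prime_X.pow_dvd_of_dvd_mul_right N (b := 1 - 2 * C c * (X + C c * f)) ?_
    ⟨-2 * g + (1 - C c * X * φ) * (C (N : K) * g) + (X - C c * f) * derivative g, ?_⟩
  · rw [X_dvd_iff, hφ]
    simp
  · have h1 : X - C c * f = X * (1 - C c * X * φ) := by rw [hφ]; ring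
    have h2 : (X - C c * f) * (C (N : K) * X ^ (N - 1) * g) =
        X ^ N * ((1 - C c * X * φ) * (C (N : K) * g)) := by rw [h1, hX]; ring
    have h3 : C (2 : K) = 2 := rfl
    rw [h3] at hd
    linear_combination (X - C c * f) * hd - 2 * hg + h2

/-- The map `p ↦ 3 p + h p'` on polynomials, corrected in the degrees 0 and 2. -/
noncomputable def weightMap (h : K[X]) (κ : K) (m : ℕ) : K[X] →ₗ[K] K[X] :=
  (3 : K) • LinearMap.id + (LinearMap.mulLeft K h).comp derivative -
    κ • ((monomial m).comp (lcoeff K 0) + (monomial (m + 2)).comp (lcoeff K 2))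

theorem weightMap_apply (h : K[X]) (κ : K) (m : ℕ) (p : K[X]) :
    weightMap h κ m p = 3 * p + h * derivative p -
      C κ * (C (p.coeff 0) * X ^ m + C (p.coeff 2) * X ^ (m + 2)) := by
  have h3 : C (3 : K) = 3 := rfl
  simp [weightMap, smul_eq_C_mul, ← C_mul_X_pow_eq_monomial, h3, mul_add]

theorem weightMap_sub_dvd {c : K} {f : K[X]} (hf : X ^ 2 ∣ f) (κ : K) {m : ℕ} (hm : 1 ≤ m)
    (k : ℕ) :
    X ^ (k + 1) ∣ weightMap (X - C c * f) κ m (X ^ k) - ((k + 3 : ℕ) : K) • X ^ k := by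
  obtain ⟨φ, rfl⟩ := hf
  have h1 : X ^ (k + 1) ∣ C κ * (C ((X ^ k : K[X]).coeff 0) * X ^ m +
      C ((X ^ k : K[X]).coeff 2) * X ^ (m + 2)) := by
    refine dvd_mul_of_dvd_right (dvd_add ?_ ?_) _
    · rw [coeff_X_pow]
      split_ifs with h
      · subst h
        exact dvd_mul_of_dvd_right (pow_dvd_pow _ hm) _
      · simp
    · rw [coeff_X_pow]
      split_ifs with h
      · subst h
        exact dvd_mul_of_dvd_right (pow_dvd_pow _ (by omega)) _
      · simp
  rw [weightMap_apply, sub_right_comm]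
  refine dvd_sub ?_ h1
  rw [derivative_X_pow, smul_eq_C_mul]
  rcases k with _ | k
  · have h3 : C (3 : K) = 3 := rfl
    simp [h3]
  · refine ⟨-(C c * φ * C ((k + 1 : ℕ) : K)), ?_⟩
    have h3 : C (((k + 1 + 3 : ℕ)) : K) = C ((k + 1 : ℕ) : K) + 3 := by
      have h3 : C (3 : K) = 3 := rfl
      rw [Nat.cast_add, C_add, Nat.cast_ofNat, h3]
    rw [h3, Nat.add_sub_cancel]
    ring

namespace AdaptedFamily

variable {n : ℕ} {E : ℕ → L}

theorem exists_decomposition (hE : AdaptedFamily K n E) (x : L) :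
    ∃ (a b : K) (p : K[X]), x = a • E 1 + b • E 2 + polyMap K E p := by
  obtain ⟨a, ha⟩ := tailSpan_split E (hE.mem_one x)
  obtain ⟨b, hb⟩ := tailSpan_split E ha
  obtain ⟨p, hp⟩ := hE.exists_polyMap_eq hb
  exact ⟨a, b, p, by rw [hp]; abel⟩

/-- The image e₁ - c e₂ acts as X - c f, which is the commutator of the uncorrected map (κ = 0) with
X. The degree n - 5 makes the corrections -κ e_{n-2} at e₃ and -κ e_n at e₅. -/
theorem exists_weightMap (hE : AdaptedFamily K n E) (hn : 12 ≤ n)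
    (hext : ∀ g : ℕ → L, ∃ P : L →ₗ[K] L, ∀ i, 1 ≤ i → i ≤ n → P (E i) = g i)
    (c κ : K) {f : K[X]} (hf : X ^ 2 ∣ f) :
    ∃ P : L →ₗ[K] L, HasWeights P E ∧ ∀ (a b : K) (p : K[X]),
      P (a • E 1 + b • E 2 + polyMap K E p) =
        a • E 1 + (2 * b - c * a) • E 2 +
          polyMap K E (weightMap (X - C c * f) κ (n - 5) p) := by
  set R := weightMap (X - C c * f) κ (n - 5) with hR
  obtain ⟨P, hP⟩ := hext fun i =>
    if i = 1 then E 1 - c • E 2 else if i = 2 then (2 : K) • E 2 else polyMap K E (R (X ^ (i - 3)))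
  have h1 : P (E 1) = E 1 - c • E 2 := by simpa using hP 1 le_rfl (by omega)
  have h2 : P (E 2) = (2 : K) • E 2 := by simpa using hP 2 (by omega) (by omega)
  have hRX : ∀ k, X ^ (k + 1) ∣ R (X ^ k) - ((k + 3 : ℕ) : K) • X ^ k := fun k =>
    weightMap_sub_dvd hf κ (by omega) k
  have h3 : ∀ k, P (E (k + 3)) = polyMap K E (R (X ^ k)) := by
    intro k
    by_cases hk : k + 3 ≤ n
    · simpa using hP (k + 3) (by omega) hk
    · rw [hE.eq_zero _ (by omega), map_zero, eq_comm, hE.polyMap_eq_zero_iff (by omega)]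
      have h4 := dvd_add (dvd_trans (pow_dvd_pow X (Nat.le_succ k)) (hRX k))
        (dvd_smul_of_dvd ((k + 3 : ℕ) : K) (dvd_refl ((X : K[X]) ^ k)))
      rw [sub_add_cancel] at h4
      exact dvd_trans (pow_dvd_pow X (by omega)) h4
  have hp : ∀ p, P (polyMap K E p) = polyMap K E (R p) := by
    intro p
    induction p using Polynomial.induction_on' with
    | add p q hp hq => rw [map_add, map_add, hp, hq, map_add, map_add]
    | monomial m a =>
      rw [← mul_one a, ← smul_eq_mul, ← smul_monomial, monomial_one_right_eq_X_pow, map_smul,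
        map_smul, map_smul, map_smul, hE.polyMap_X_pow, h3]
  refine ⟨P, fun j hj => ?_, fun a b p => ?_⟩
  · obtain rfl | rfl | hj : j = 1 ∨ j = 2 ∨ 3 ≤ j := by omega
    · rw [h1]
      simpa using Submodule.smul_mem _ c (mem_tailSpan E (le_refl 2))
    · rw [h2]
      simp
    · obtain ⟨k, rfl⟩ : ∃ k, j = k + 3 := ⟨j - 3, by omega⟩
      rw [← hE.polyMap_X_pow, hp, ← map_smul, ← map_sub]
      exact tailSpan_anti E (by omega) (hE.polyMap_mem (hRX k))
  · rw [map_add, map_add, map_smul, map_smul, h1, h2, hp]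
    module

theorem lie_decomposition (hE : AdaptedFamily K n E)
    (hc : ∀ x ∈ tailSpan K E 3, ∀ y ∈ tailSpan K E 3, ⁅x, y⁆ = 0) {f : K[X]}
    (hf : ⁅E 2, E 3⁆ = polyMap K E f) (b₁ b₂ c₁ c₂ : K) (q r : K[X]) :
    ⁅b₁ • E 1 + b₂ • E 2 + polyMap K E q, c₁ • E 1 + c₂ • E 2 + polyMap K E r⁆ =
      polyMap K E (C (b₁ * c₂ - b₂ * c₁) + (C b₁ * X + C b₂ * f) * r -
        (C c₁ * X + C c₂ * f) * q) := by
  have e1 : ∀ p, ⁅polyMap K E p, E 1⁆ = -polyMap K E (X * p) := fun p => by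
    rw [polyMap_X_mul, lie_skew]
  have e2 : ∀ p, ⁅polyMap K E p, E 2⁆ = -polyMap K E (f * p) := fun p => by
    rw [← hE.lie_two_polyMap hc hf, lie_skew]
  have e21 : ⁅E 2, E 1⁆ = -polyMap K E 1 := by
    rw [← lie_skew, hE.lie_one 2 le_rfl, polyMap_one]
  simp only [add_lie, lie_add, smul_lie, lie_smul, lie_self, e1, e2, e21,
    hE.lie_one 2 le_rfl, hE.lie_two_polyMap hc hf, ← polyMap_X_mul,
    hc _ (hE.polyMap_tail q) _ (hE.polyMap_tail r)]
  have h3 : E (2 + 1) = polyMap K E 1 := by rw [polyMap_one]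
  simp only [h3, ← map_smul, ← map_neg, ← map_add, smul_zero, add_zero, zero_add]
  congr 1
  simp only [smul_eq_C_mul, C_sub, C_mul]
  ring

/-- Here (X - c f) f' - 2f ≡ κ X^(n-3) mod X^(n-2). This defect shows up in [e₂,[y,z]] when [y,z]
has an e₃-component, and the correction at e₅ cancels it. The correction at e₃ keeps e₅ =
[e₁,[e₁,e₃]] consistent; it disturbs only the single bracket [e₁,e₂] = e₃, which a prederivation
need not respect. -/
theorem exists_prederivation [CharZero K] (hE : AdaptedFamily K n E) (hn : 12 ≤ n)
    (hext : ∀ g : ℕ → L, ∃ P : L →ₗ[K] L, ∀ i, 1 ≤ i → i ≤ n → P (E i) = g i)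
    (hc : ∀ x ∈ tailSpan K E 3, ∀ y ∈ tailSpan K E 3, ⁅x, y⁆ = 0) {f : K[X]}
    (hf : ⁅E 2, E 3⁆ = polyMap K E f) (hf2 : X ^ 3 ∣ f - X ^ 2) {c : K}
    (hfc : X ^ (n - 3) ∣ f - (X + C c * f) ^ 2) :
    ∃ P : L →ₗ[K] L, IsPrederivation P ∧ HasWeights P E := by
  obtain ⟨φ, hφ⟩ := hf2
  have hφ' : f = X * (X * (1 + X * φ)) := by linear_combination hφ
  have hX2 : X ^ 2 ∣ f := ⟨1 + X * φ, by linear_combination hφ'⟩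
  obtain ⟨g', hg'⟩ := X_pow_dvd_mul_derivative_sub hX2 hfc
  obtain ⟨κ, g, rfl⟩ : ∃ κ g, g' = C κ + X * g :=
    ⟨g'.coeff 0, g'.divX, by rw [add_comm]; exact (X_mul_divX_add g').symm⟩
  obtain ⟨m, rfl⟩ : ∃ m, n = m + 5 := ⟨n - 5, by omega⟩
  rw [show m + 5 - 3 = m + 2 by omega] at hg'
  obtain ⟨P, hw, hP⟩ := hE.exists_weightMap hn hext c κ hX2
  rw [show m + 5 - 5 = m by omega] at hP
  refine ⟨P, fun x y z => ?_, hw⟩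
  obtain ⟨a₁, a₂, p, rfl⟩ := hE.exists_decomposition x
  obtain ⟨b₁, b₂, q, rfl⟩ := hE.exists_decomposition y
  obtain ⟨c₁, c₂, r, rfl⟩ := hE.exists_decomposition z
  have hlie : ∀ (a b : K) (p w : K[X]), ⁅a • E 1 + b • E 2 + polyMap K E p, polyMap K E w⁆ =
      polyMap K E ((C a * X + C b * f) * w) := fun a b p w => by
    simpa using hE.lie_decomposition hc hf a b 0 0 p w
  have hPp : ∀ p, P (polyMap K E p) = polyMap K E (weightMap (X - C c * f) κ m p) := fun p => by
    simpa using hP 0 0 p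
  simp only [hP, hE.lie_decomposition hc hf, hlie, hPp, ← map_add]
  rw [← sub_eq_zero, ← map_sub, hE.polyMap_eq_zero_iff (by omega),
    show m + 5 - 2 = m + 3 by omega]
  set w := C (b₁ * c₂ - b₂ * c₁) + (C b₁ * X + C b₂ * f) * r - (C c₁ * X + C c₂ * f) * q with hwdef
  have f0 : f.coeff 0 = 0 := by rw [hφ']; simp
  have f1 : f.coeff 1 = 0 := by rw [hφ', coeff_X_mul]; simp
  have f2 : f.coeff 2 = 1 := by rw [hφ', coeff_X_mul, coeff_X_mul]; simp
  have w0 : ((C a₁ * X + C a₂ * f) * w).coeff 0 = 0 := by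
    simp [mul_coeff_zero, f0]
  have w2 : ((C a₁ * X + C a₂ * f) * w).coeff 2 =
      a₁ * (b₁ * r.coeff 0 - c₁ * q.coeff 0) + a₂ * (b₁ * c₂ - b₂ * c₁) := by
    simp [hwdef, coeff_mul, Finset.Nat.antidiagonal_succ, f0, f1, f2, coeff_X, coeff_C]
  rw [weightMap_apply, w0, w2]
  set s := a₁ * (b₁ * r.coeff 0 - c₁ * q.coeff 0) + a₂ * (b₁ * c₂ - b₂ * c₁) with hs
  simp only [weightMap_apply]
  set F := X * (1 + X * φ) with hF
  -- After substituting `hg'`, the prederivation identity fails by X^(m+2) Q. The constant term of Q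
  -- vanishes because s is the X²-coefficient of [x,[y,z]]; this gives the missing power.
  set Q := C a₂ * (C κ + X * g) * w + X * (C a₁ + C a₂ * F) * (C κ + X * g) *
      (C b₂ * r - C c₂ * q) + (C a₁ + C a₂ * F) * C κ *
      ((C b₁ + C b₂ * F) * (C (r.coeff 0) + C (r.coeff 2) * X ^ 2) -
        (C c₁ + C c₂ * F) * (C (q.coeff 0) + C (q.coeff 2) * X ^ 2)) - C κ * C s with hQ
  have hQX : X ∣ Q := by
    rw [X_dvd_iff]
    simp [hQ, hF, hs, hwdef, mul_coeff_zero, f0]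
    ring
  obtain ⟨Q', hQ'⟩ := hQX
  refine ⟨Q', ?_⟩
  have hdw : derivative ((C a₁ * X + C a₂ * f) * w) = (C a₁ + C a₂ * derivative f) * w +
      (C a₁ * X + C a₂ * f) * ((C b₁ + C b₂ * derivative f) * r +
        (C b₁ * X + C b₂ * f) * derivative r - (C c₁ + C c₂ * derivative f) * q -
        (C c₁ * X + C c₂ * f) * derivative q) := by
    simp only [hwdef, derivative_mul, derivative_add, derivative_sub, derivative_C, derivative_X]
    ring
  have e : X ^ (m + 3) * Q' = X ^ (m + 2) * Q := by rw [hQ']; ring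
  have h2 : C (2 : K) = 2 := rfl
  rw [e, hdw, hQ]
  simp only [C_sub, C_mul, C_0, h2]
  generalize derivative f = f' at hg' ⊢
  clear_value s F
  rw [hwdef, hφ'] at *
  simp only [C_sub, C_mul] at *
  linear_combination (C a₂ * ((C b₁ * C c₂ - C b₂ * C c₁) + (C b₁ * X + C b₂ * (X * F)) * r -
    (C c₁ * X + C c₂ * (X * F)) * q) + (C a₁ * X + C a₂ * (X * F)) * (C b₂ * r - C c₂ * q)) * hg'

/-- With the congruence modulo X^(n-2) there is no defect, and the uncorrected map (κ = 0) already
respects single brackets. -/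
theorem exists_derivation [CharZero K] (hE : AdaptedFamily K n E) (hn : 12 ≤ n)
    (hext : ∀ g : ℕ → L, ∃ P : L →ₗ[K] L, ∀ i, 1 ≤ i → i ≤ n → P (E i) = g i)
    (hc : ∀ x ∈ tailSpan K E 3, ∀ y ∈ tailSpan K E 3, ⁅x, y⁆ = 0) {f : K[X]}
    (hf : ⁅E 2, E 3⁆ = polyMap K E f) (hf2 : X ^ 2 ∣ f) {c : K}
    (hfc : X ^ (n - 2) ∣ f - (X + C c * f) ^ 2) :
    ∃ D : LieDerivation K L L, HasWeights (D : L →ₗ[K] L) E := by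
  obtain ⟨g, hg⟩ := X_pow_dvd_mul_derivative_sub hf2 hfc
  obtain ⟨P, hw, hP⟩ := hE.exists_weightMap hn hext c 0 hf2
  have hPp : ∀ p, P (polyMap K E p) = polyMap K E (weightMap (X - C c * f) 0 (n - 5) p) :=
    fun p => by simpa using hP 0 0 p
  refine ⟨⟨P, fun y z => ?_⟩, hw⟩
  obtain ⟨b₁, b₂, q, rfl⟩ := hE.exists_decomposition y
  obtain ⟨c₁, c₂, r, rfl⟩ := hE.exists_decomposition z
  simp only [hP, hE.lie_decomposition hc hf, hPp, ← map_sub]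
  rw [← sub_eq_zero, ← map_sub, hE.polyMap_eq_zero_iff (by omega)]
  refine ⟨g * (C b₂ * r - C c₂ * q), ?_⟩
  have h2 : C (2 : K) = 2 := rfl
  simp only [weightMap_apply, derivative_mul, derivative_add, derivative_sub, derivative_C,
    derivative_X, C_sub, C_mul, C_0, h2]
  linear_combination (C b₂ * r - C c₂ * q) * hg

end AdaptedFamily

end Construction

/-! ### Solving f = (X + c f)² by Catalan numbers. -/

section CatalanSeries

variable {K : Type*} [Field K]

open PowerSeries in
/-- The solution `f = X² + 2 c X³ + ⋯` of the equation `f = (X + c f)²`. -/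
noncomputable def squareSeries (c : K) : PowerSeries K :=
  (X * rescale c (PowerSeries.map (Nat.castRingHom K) catalanSeries)) ^ 2

open PowerSeries in
-- The Catalan equation, rescaled, says S = 1 + c X S², so τ = X S satisfies τ = X + c τ².
theorem squareSeries_eq (c : K) :
    squareSeries c = (X + C c * squareSeries c) ^ 2 := by
  have h := congrArg (fun s => rescale c (PowerSeries.map (Nat.castRingHom K) s))
    catalanSeries_sq_mul_X_add_one
  simp only [map_add, map_mul, map_pow, map_one, PowerSeries.map_X, rescale_X] at h
  unfold squareSeries
  set S := rescale c (PowerSeries.map (Nat.castRingHom K) catalanSeries)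
  have e : X + C c * (X * S) ^ 2 = X * S := by linear_combination X * h
  rw [e]

open PowerSeries in
theorem coeff_squareSeries (c : K) (m : ℕ) :
    coeff (m + 2) (squareSeries c) = catalan (m + 1) * c ^ m := by
  have h := congrArg (coeff (m + 1)) catalanSeries_sq_mul_X_add_one
  rw [map_add, coeff_succ_mul_X, catalanSeries_coeff, coeff_one, if_neg (by omega), add_zero] at h
  rw [squareSeries, mul_pow, coeff_X_pow_mul, ← map_pow, ← map_pow, coeff_rescale, coeff_map, h]
  simp [mul_comm]

open PowerSeries in
theorem coeff_squareSeries_of_lt (c : K) {m : ℕ} (hm : m < 2) : coeff m (squareSeries c) = 0 :=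
  X_pow_dvd_iff.1 ⟨_, mul_pow _ _ _⟩ m hm

open PowerSeries in
-- The defect of f equals f - G up to a multiple of X (f - G), so agreement with the exact solution
-- G improves by one power at a time.
theorem X_pow_dvd_sub_squareSeries_iff {c : K} {f : PowerSeries K} (hf : X ∣ f) (N : ℕ) :
    X ^ N ∣ f - (X + C c * f) ^ 2 ↔ X ^ N ∣ f - squareSeries c := by
  have hG := squareSeries_eq c
  have hGX : X ∣ squareSeries c := X_dvd_iff.2 (by
    simpa using coeff_squareSeries_of_lt c (m := 0) (by omega))
  set G := squareSeries c
  have e : f - (X + C c * f) ^ 2 = (f - G) - (f - G) * (C c * (2 * X + C c * f + C c * G)) := by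
    linear_combination hG
  constructor
  · intro h
    have all : ∀ k, k ≤ N → X ^ k ∣ f - G := by
      intro k
      induction k with
      | zero => simp
      | succ k ih =>
        intro hk
        have h1 : X ∣ C c * (2 * X + C c * f + C c * G) :=
          dvd_mul_of_dvd_right (dvd_add (dvd_add (dvd_mul_left _ _) (dvd_mul_of_dvd_right hf _))
            (dvd_mul_of_dvd_right hGX _)) _
        have h2 := dvd_add (dvd_trans (pow_dvd_pow X hk) h)
          ((pow_succ (X : PowerSeries K) k).symm ▸ mul_dvd_mul (ih (by omega)) h1)
        rwa [e, sub_add_cancel] at h2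
    exact all N le_rfl
  · intro h
    rw [e]
    exact dvd_sub h (dvd_mul_of_dvd_left h _)

open Polynomial in
theorem X_pow_dvd_sub_sq_iff_coeff {c : K} {f : K[X]} (hf : X ∣ f) (N : ℕ) :
    X ^ N ∣ f - (X + C c * f) ^ 2 ↔
      ∀ m < N, f.coeff m = PowerSeries.coeff m (squareSeries c) := by
  have hf' : PowerSeries.X ∣ (f : PowerSeries K) := by
    obtain ⟨g, rfl⟩ := hf
    exact ⟨g, by simp⟩
  have h := X_pow_dvd_sub_squareSeries_iff (c := c) hf' N
  have e : (f : PowerSeries K) - (PowerSeries.X + PowerSeries.C c * (f : PowerSeries K)) ^ 2 =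
      ((f - (X + C c * f) ^ 2 : K[X]) : PowerSeries K) := by simp
  rw [e, PowerSeries.X_pow_dvd_iff, PowerSeries.X_pow_dvd_iff] at h
  simp only [Polynomial.coeff_coe, map_sub] at h
  rw [Polynomial.X_pow_dvd_iff, h]
  simp only [sub_eq_zero]

theorem catalan_mul_half_pow [CharZero K] (a : K) {j : ℕ} (hj : 5 ≤ j) :
    1 / (2 ^ (j - 5) * ((j : K) - 3)) * ((2 * j - 8).choose (j - 4) : K) * a ^ (j - 5) =
      catalan (j - 4) * (a / 2) ^ (j - 5) := by
  obtain ⟨m, rfl⟩ : ∃ m, j = m + 4 := ⟨j - 4, by omega⟩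
  have h := congrArg (Nat.cast (R := K)) (succ_mul_catalan_eq_centralBinom m)
  rw [Nat.centralBinom] at h
  rw [show 2 * (m + 4) - 8 = 2 * m by omega, Nat.add_sub_cancel, ← h]
  have h1 : ((m + 4 : ℕ) : K) - 3 = ((m + 1 : ℕ) : K) := by push_cast; ring
  have h2 : ((m + 1 : ℕ) : K) ≠ 0 := Nat.cast_ne_zero.2 (Nat.succ_ne_zero m)
  rw [h1, Nat.cast_mul, div_pow]
  field_simp

open Polynomial in
-- The X³-coefficient forces 2c = a 6, and N ≥ 4 makes it visible; the remaining coefficients are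
-- then rescaled Catalan numbers.
theorem exists_X_pow_dvd_iff [CharZero K] {a : ℕ → K} {f : K[X]} {N : ℕ} (hN : 4 ≤ N)
    (hf : ∀ m < N, f.coeff m = a (m + 3)) (h3 : a 3 = 0) (h4 : a 4 = 0) (h5 : a 5 = 1) :
    (∃ c : K, X ^ N ∣ f - (X + C c * f) ^ 2) ↔ ∀ j, 7 ≤ j → j < N + 3 →
      a j = 1 / (2 ^ (j - 5) * ((j : K) - 3)) * ((2 * j - 8).choose (j - 4) : K)
        * a 6 ^ (j - 5) := by
  have hfX : X ∣ f := X_dvd_iff.2 (by rw [hf 0 (by omega), h3])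
  have key : ∀ (c : K) (m : ℕ), 2 ≤ m → PowerSeries.coeff m (squareSeries c) = catalan (m - 1) * c ^ (m - 2) :=
    fun c m hm => by
      obtain ⟨i, rfl⟩ : ∃ i, m = i + 2 := ⟨m - 2, by omega⟩
      exact coeff_squareSeries c i
  simp only [X_pow_dvd_sub_sq_iff_coeff hfX]
  constructor
  · rintro ⟨c, h⟩ j hj hjN
    have h6 : a 6 = 2 * c := by
      rw [← hf 3 (by omega), h 3 (by omega), key c 3 (by omega)]
      simp [catalan_two]
    have hc : a 6 / 2 = c := by rw [h6]; field_simp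
    obtain ⟨m, rfl⟩ : ∃ m, j = m + 3 := ⟨j - 3, by omega⟩
    rw [catalan_mul_half_pow _ (by omega), ← hf m (by omega), h m (by omega), key c m (by omega), hc]
    rfl
  · intro h
    refine ⟨a 6 / 2, fun m hm => ?_⟩
    rw [hf m hm]
    obtain rfl | rfl | rfl | rfl | hm4 : m = 0 ∨ m = 1 ∨ m = 2 ∨ m = 3 ∨ 4 ≤ m := by omega
    · rw [h3, coeff_squareSeries_of_lt _ (by omega)]
    · rw [h4, coeff_squareSeries_of_lt _ (by omega)]
    · rw [h5, key _ _ le_rfl]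
      simp
    · rw [key _ _ (by omega)]
      simp [catalan_two]
      field_simp
    · rw [h (m + 3) (by omega) (by omega), catalan_mul_half_pow _ (by omega), key _ _ (by omega)]
      rfl

end CatalanSeries

/-! ### From structure constants to the filtered setting. -/

section AdaptedBasis

variable {K L : Type*} [Field K] [LieRing L] [LieAlgebra K L] {n : ℕ}

theorem basisVec_succ (e : Module.Basis (Fin n) K L) (i : Fin n) :
    basisVec e (i + 1) = e i := by
  rw [basisVec, dif_pos ⟨by omega, by omega⟩]
  rfl

theorem basisVec_eq_zero (e : Module.Basis (Fin n) K L) {i : ℕ} (hi : n < i) :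
    basisVec e i = 0 := dif_neg (by omega)

theorem coord_basisVec (e : Module.Basis (Fin n) K L) (k : Fin n) (r : ℕ) :
    e.coord k (basisVec e r) = if r = k + 1 then 1 else 0 := by
  unfold basisVec
  split_ifs with h1 h2 h2
  · subst h2
    simp
  · have : (⟨r - 1, by omega⟩ : Fin n) ≠ k := by
      rintro rfl
      simp at h2
      omega
    simp [this]
  · omega
  · simp

theorem coeff_eq_zero_of_sum_eq_zero (e : Module.Basis (Fin n) K L) {a : ℕ → K}
    (h : ∑ r ∈ Finset.Icc 1 n, a r • basisVec e r = 0) {k : ℕ} (hk : 1 ≤ k) (hkn : k ≤ n) :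
    a k = 0 := by
  have h1 := congrArg (e.coord ⟨k - 1, by omega⟩) h
  rw [map_sum, map_zero] at h1
  simp only [map_smul, coord_basisVec, Nat.sub_add_cancel hk, smul_eq_mul, mul_ite, mul_one,
    mul_zero, Finset.sum_ite_eq', Finset.mem_Icc] at h1
  rwa [if_pos ⟨hk, hkn⟩] at h1

theorem exists_linearMap_basisVec (e : Module.Basis (Fin n) K L) (g : ℕ → L) :
    ∃ P : L →ₗ[K] L, ∀ i, 1 ≤ i → i ≤ n → P (basisVec e i) = g i := by
  refine ⟨e.constr K fun i => g (i + 1), fun i hi hin => ?_⟩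
  obtain ⟨j, rfl⟩ : ∃ j : Fin n, i = j + 1 := ⟨⟨i - 1, by omega⟩, by simp; omega⟩
  rw [basisVec_succ, Module.Basis.constr_basis]

namespace IsAdaptedBasis

variable {e : Module.Basis (Fin n) K L} {α : ℕ → ℕ → K}

theorem lie_one_all (he : IsAdaptedBasis e α) {i : ℕ} (hi : 2 ≤ i) :
    ⁅basisVec e 1, basisVec e i⁆ = basisVec e (i + 1) := by
  rcases lt_trichotomy i n with h | rfl | h
  · exact he.lie_one i hi (by omega)
  · rw [he.lie_one_last, basisVec_eq_zero e (Nat.lt_succ_self i)]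
  · rw [basisVec_eq_zero e h, basisVec_eq_zero e (by omega : n < i + 1), lie_zero]

theorem lie_succ (he : IsAdaptedBasis e α) {k : ℕ} (hk : 2 ≤ k) (hkn : k + 1 ≤ n) :
    ⁅basisVec e k, basisVec e (k + 1)⁆ = ∑ r ∈ Finset.Icc 1 n, α k r • basisVec e r := by
  rw [he.lie_lie k (k + 1) hk (Nat.lt_succ_self k) hkn]
  refine Finset.sum_congr rfl fun r hr => ?_
  rw [show (k + 1 - k - 1) / 2 + 1 = 1 by omega, Finset.sum_range_one,
    show r + k + 2 * 0 + 1 - (k + 1) = r by omega]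
  simp

theorem basisVec_mem_lcs (he : IsAdaptedBasis e α) (m : ℕ) :
    basisVec e (m + 2) ∈ lcsTerm K L m := by
  induction m with
  | zero => simp [lcsTerm]
  | succ m ih =>
    rw [show m + 1 + 2 = m + 2 + 1 by omega, ← he.lie_one_all (by omega), lcsTerm,
      LieModule.lowerCentralSeries_succ]
    exact LieSubmodule.lie_mem_lie (LieSubmodule.mem_top _) ih

/-- Both e_{n/2} and e_{n/2+1} lie in the abelian ideal, and the constant in question is the
e_n-coefficient of their bracket. -/
theorem half_eq_zero (he : IsAdaptedBasis e α) (hn : 12 ≤ n) (hB : PropertyB K L n)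
    (hev : Even n) : α (n / 2) n = 0 := by
  have h1 := he.basisVec_mem_lcs ((n - 4) / 2)
  have h2 : basisVec e ((n - 4) / 2 + 3) ∈ lcsTerm K L ((n - 4) / 2) :=
    LieModule.antitone_lowerCentralSeries K L L (Nat.le_succ _)
      (he.basisVec_mem_lcs ((n - 4) / 2 + 1))
  have h := hB hev _ h1 _ h2
  rw [he.lie_succ (by omega) (by omega)] at h
  have h3 := coeff_eq_zero_of_sum_eq_zero e h (k := n) (by omega) le_rfl
  rwa [show (n - 4) / 2 + 2 = n / 2 by omega] at h3

theorem filteredFamily (he : IsAdaptedBasis e α) (hn : 12 ≤ n) (hB : PropertyB K L n) :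
    FilteredFamily K n (basisVec e) where
  eq_zero i hi := basisVec_eq_zero e hi
  tail_one := by
    rw [eq_top_iff, ← e.span_eq, Submodule.span_le]
    rintro _ ⟨i, rfl⟩
    rw [← basisVec_succ]
    exact mem_tailSpan _ (by omega)
  lead m a hm hmn h := by
    have h1 : tailSpan K (basisVec e) (m + 1) ≤ LinearMap.ker (e.coord ⟨m - 1, by omega⟩) := by
      refine tailSpan_le fun r hr => ?_
      rw [LinearMap.mem_ker, coord_basisVec, if_neg (by simp; omega)]
    have h2 := h1 h
    rw [LinearMap.mem_ker, map_smul, coord_basisVec, if_pos (by simp; omega)] at h2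
    simpa using h2
  lie_one i hi := he.lie_one_all hi
  lie_mem := by
    have hlt : ∀ i j, 2 ≤ i → i < j → j ≤ n →
        ⁅basisVec e i, basisVec e j⁆ ∈ tailSpan K (basisVec e) (i + j) := by
      intro i j hi hij hj
      rw [he.lie_lie i j hi hij hj]
      refine Submodule.sum_mem _ fun r hr => ?_
      by_cases hr' : i + j ≤ r
      · exact Submodule.smul_mem _ _ (mem_tailSpan _ hr')
      rw [Finset.sum_eq_zero, zero_smul]
      · exact Submodule.zero_mem _
      · intro l hl
        rw [Finset.mem_range] at hl
        suffices h : α (i + l) (r + i + 2 * l + 1 - j) = 0 by rw [h, mul_zero]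
        -- For r < i + j the second index is below 2(i + l) + 1, so only the exceptional pair (n/2,
        -- n) could contribute.
        by_cases hev : Even n ∧ (i + l, r + i + 2 * l + 1 - j) = (n / 2, n)
        · rw [Prod.mk.injEq] at hev
          rw [hev.2.1, hev.2.2]
          exact he.half_eq_zero hn hB hev.1
        · refine he.support _ _ ?_
          rintro (⟨h1, h2, h3, h4⟩ | h)
          · simp only at h1 h2 h3 h4
            omega
          · exact hev h
    intro i j hi hj
    rcases lt_trichotomy i j with h | rfl | h
    · by_cases hjn : j ≤ n
      · exact hlt i j hi h hjn
      · simp [basisVec_eq_zero e (by omega : n < j)]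
    · simp
    · by_cases hin : i ≤ n
      · rw [← lie_skew, add_comm]
        exact Submodule.neg_mem _ (hlt j i hj h hin)
      · simp [basisVec_eq_zero e (by omega : n < i)]

end IsAdaptedBasis

theorem FilteredFamily.lcs_le {E : ℕ → L} (hE : FilteredFamily K n E) (m : ℕ) :
    ∀ x ∈ lcsTerm K L (m + 1), x ∈ tailSpan K E (m + 3) := by
  suffices h : (lcsTerm K L (m + 1)).toSubmodule ≤ tailSpan K E (m + 3) from fun x hx => h hx
  induction m with
  | zero =>
    rw [lcsTerm, LieModule.lowerCentralSeries_succ, LieSubmodule.lieIdeal_oper_eq_linear_span',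
      Submodule.span_le]
    rintro _ ⟨x, -, y, -, rfl⟩
    exact hE.lie_mem_three x y
  | succ m ih =>
    rw [lcsTerm, LieModule.lowerCentralSeries_succ, LieSubmodule.lieIdeal_oper_eq_linear_span',
      Submodule.span_le]
    rintro _ ⟨x, -, y, hy, rfl⟩
    exact hE.lie_any (j := m + 3) (by omega) (by omega) x (ih hy)

namespace IsAdaptedBasis

variable {e : Module.Basis (Fin n) K L} {α : ℕ → ℕ → K}

theorem eq_zero_of_lt (he : IsAdaptedBasis e α) {k s : ℕ} (hk : 2 * k < n)
    (hs : s < 2 * k + 1) : α k s = 0 := by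
  refine he.support k s ?_
  rintro (⟨h1, h2, h3, h4⟩ | ⟨h1, h2⟩)
  · simp only at h1 h2 h3 h4
    omega
  · rw [Prod.mk.injEq] at h2
    omega

theorem adaptedFamily (he : IsAdaptedBasis e α) (hn : 12 ≤ n) (hB : PropertyB K L n)
    (hC : PropertyC K L) (hα : α 2 5 = 1) : AdaptedFamily K n (basisVec e) where
  toFilteredFamily := he.filteredFamily hn hB
  lie_two_three := by
    have h5 : 5 ∈ Finset.Icc 1 n := Finset.mem_Icc.2 ⟨by omega, by omega⟩
    rw [he.lie_succ (k := 2) le_rfl (by omega), ← Finset.add_sum_erase _ _ h5, hα, one_smul,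
      add_sub_cancel_left]
    refine Submodule.sum_mem _ fun r hr => ?_
    rw [Finset.mem_erase] at hr
    by_cases hr6 : 6 ≤ r
    · exact Submodule.smul_mem _ _ (mem_tailSpan _ hr6)
    · rw [he.eq_zero_of_lt (by omega) (by omega), zero_smul]
      exact Submodule.zero_mem _
  lie_three_four := by
    refine (he.filteredFamily hn hB).lcs_le 5 _ (hC _ (he.basisVec_mem_lcs 1) _ ?_)
    exact LieModule.antitone_lowerCentralSeries K L L (Nat.le_succ 1) (he.basisVec_mem_lcs 2)

/-- The list starts at i = 8 since α_{3,7} = 0 already follows from [e₃,e₄] being at level 8. -/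
theorem lie_three_four_eq_zero_iff (he : IsAdaptedBasis e α)
    (hE : AdaptedFamily K n (basisVec e)) (hn : 12 ≤ n) :
    ⁅basisVec e 3, basisVec e 4⁆ = 0 ↔ ∀ i, 8 ≤ i → i ≤ n → α 3 i = 0 := by
  have h34 := he.lie_succ (k := 3) (by omega) (by omega)
  constructor
  · intro h i hi hin
    rw [h34] at h
    exact coeff_eq_zero_of_sum_eq_zero e h (by omega) hin
  · intro h
    have h0 : ∀ r ∈ Finset.Icc 1 n, r ≠ 7 → α 3 r • basisVec e r = 0 := by
      intro r hr hr7
      rw [Finset.mem_Icc] at hr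
      rcases lt_or_ge r 8 with hr8 | hr8
      · rw [he.eq_zero_of_lt (by omega) (by omega), zero_smul]
      · rw [h r hr8 hr.2, zero_smul]
    have h7 : ⁅basisVec e 3, basisVec e 4⁆ = α 3 7 • basisVec e 7 := by
      rw [h34]
      exact Finset.sum_eq_single 7 h0 fun h => absurd (Finset.mem_Icc.2 ⟨by omega, by omega⟩) h
    have h8 := hE.lie_three_four
    rw [h7] at h8
    rw [h7, hE.lead 7 _ (by omega) (by omega) h8, zero_smul]

open Polynomial in
theorem exists_polynomial (he : IsAdaptedBasis e α) (hE : AdaptedFamily K n (basisVec e))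
    (hn : 12 ≤ n) :
    ∃ f : K[X], ⁅basisVec e 2, basisVec e 3⁆ = polyMap K (basisVec e) f ∧
      ∀ m < n - 2, f.coeff m = α 2 (m + 3) := by
  refine ⟨∑ m ∈ Finset.range (n - 2), C (α 2 (m + 3)) * X ^ m, ?_, fun m hm => ?_⟩
  · rw [he.lie_succ (k := 2) le_rfl (by omega), map_sum]
    have h1 : ∑ r ∈ Finset.Icc 1 n, α 2 r • basisVec e r =
        ∑ r ∈ Finset.Ico 3 (n + 1), α 2 r • basisVec e r := by
      symm
      refine Finset.sum_subset (fun r hr => ?_) fun r hr hr' => ?_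
      · rw [Finset.mem_Ico] at hr
        exact Finset.mem_Icc.2 ⟨by omega, by omega⟩
      · rw [Finset.mem_Icc] at hr
        rw [Finset.mem_Ico] at hr'
        rw [he.eq_zero_of_lt (by omega) (by omega), zero_smul]
    rw [h1, Finset.sum_Ico_eq_sum_range, show n + 1 - 3 = n - 2 by omega]
    refine Finset.sum_congr rfl fun m _ => ?_
    rw [← smul_eq_C_mul, map_smul, hE.polyMap_X_pow, add_comm]
  · simp only [finsetSum_coeff, coeff_C_mul_X_pow]
    rw [Finset.sum_ite_eq, if_pos (Finset.mem_range.2 hm)]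

end IsAdaptedBasis

end AdaptedBasis

/-! ### Assembly of the two equivalences. -/

theorem HasWeights.bijective {K L : Type*} [Field K] [CharZero K] [LieRing L] [LieAlgebra K L]
    [Module.Finite K L] {n : ℕ} {E : ℕ → L} (hE : AdaptedFamily K n E) {P : L →ₗ[K] L}
    (hw : HasWeights P E) : Function.Bijective P := by
  have hinj : Function.Injective P := by
    rw [← LinearMap.ker_eq_bot, LinearMap.ker_eq_bot']
    intro x hx
    exact hw.eq_zero_of_mem hE (j := 0) one_pos (hE.mem_one x) (by simpa using hx)
  exact ⟨hinj, LinearMap.injective_iff_surjective.1 hinj⟩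

theorem mainTheorem8 {K : Type*} [Field K] [CharZero K]
    {L : Type*} [LieRing L] [LieAlgebra K L]
    (n : ℕ) (hn : 12 ≤ n) (hL : InClassA1 K L n)
    (e : Module.Basis (Fin n) K L) (α : ℕ → ℕ → K) (he : IsAdaptedBasis e α)
    (hα : α 2 5 = 1) :
    ((∃ P : L →ₗ[K] L, IsPrederivation P ∧ Function.Bijective P) ↔
      ((∀ i : ℕ, 8 ≤ i → i ≤ n → α 3 i = 0) ∧
        ∀ j : ℕ, 7 ≤ j → j ≤ n - 1 →
          α 2 j = 1 / (2 ^ (j - 5) * ((j : K) - 3)) * ((2 * j - 8).choose (j - 4) : K)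
            * α 2 6 ^ (j - 5))) ∧
    ((∃ D : LieDerivation K L L, Function.Bijective D) ↔
      (((∀ i : ℕ, 8 ≤ i → i ≤ n → α 3 i = 0) ∧
        ∀ j : ℕ, 7 ≤ j → j ≤ n - 1 →
          α 2 j = 1 / (2 ^ (j - 5) * ((j : K) - 3)) * ((2 * j - 8).choose (j - 4) : K)
            * α 2 6 ^ (j - 5)) ∧
        α 2 n = 1 / (2 ^ (n - 5) * ((n : K) - 3)) * ((2 * n - 8).choose (n - 4) : K)
          * α 2 6 ^ (n - 5))) := by
  have hE := he.adaptedFamily hn hL.propB hL.propC hα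
  have hfin := hL.filiform.finite
  have hext := exists_linearMap_basisVec e
  obtain ⟨f, hf, hcoeff⟩ := he.exists_polynomial hE hn
  have h3 : α 2 3 = 0 := he.eq_zero_of_lt (by omega) (by omega)
  have h4 : α 2 4 = 0 := he.eq_zero_of_lt (by omega) (by omega)
  have hf3 : Polynomial.X ^ 3 ∣ f - Polynomial.X ^ 2 := by
    rw [Polynomial.X_pow_dvd_iff]
    intro m hm
    rw [Polynomial.coeff_sub, Polynomial.coeff_X_pow, hcoeff m (by omega)]
    interval_cases m <;> simp [h3, h4, hα]
  have hf2 : Polynomial.X ^ 2 ∣ f :=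
    (dvd_sub_left (dvd_refl _)).1 (dvd_trans (pow_dvd_pow _ (by omega)) hf3)
  have h34 := he.lie_three_four_eq_zero_iff hE hn
  have hcomm : (∀ i, 8 ≤ i → i ≤ n → α 3 i = 0) →
      ∀ x ∈ tailSpan K (basisVec e) 3, ∀ y ∈ tailSpan K (basisVec e) 3, ⁅x, y⁆ = 0 :=
    fun h x hx y hy => hE.lie_eq_zero_of
      (fun d _ _ => by rw [h34.2 h]; exact Submodule.zero_mem _) hx hy
  have hweights : ∀ P : L →ₗ[K] L, IsPrederivation P → HasWeights P (basisVec e) →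
      ∀ i, 8 ≤ i → i ≤ n → α 3 i = 0 := fun P hP hw =>
    h34.1 (hw.lie_eq_zero hE hP (mem_tailSpan _ le_rfl) (mem_tailSpan _ (by omega)))
  -- Since X^m carries α_{2,m+3}, the modulus X^(n-3) sees α_{2,j} for j ≤ n - 1, and X^(n-2) also
  -- sees α_{2,n}.
  have iff₁ := exists_X_pow_dvd_iff (a := α 2) (f := f) (N := n - 3) (by omega)
    (fun m hm => hcoeff m (by omega)) h3 h4 hα
  have iff₂ := exists_X_pow_dvd_iff (a := α 2) (f := f) (N := n - 2) (by omega)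
    (fun m hm => hcoeff m (by omega)) h3 h4 hα
  refine ⟨⟨?_, ?_⟩, ⟨?_, ?_⟩⟩
  · rintro ⟨P, hP, hbij⟩
    obtain ⟨a, hw⟩ := hE.exists_hasWeights hn hP hbij.1
    refine ⟨hweights _ (hP.smul a) hw, fun j hj hjn => ?_⟩
    exact iff₁.1 (hw.exists_dvd_of_prederivation hE hn (hP.smul a) hf hf3) j hj (by omega)
  · rintro ⟨h, h'⟩
    obtain ⟨c, hc⟩ := iff₁.2 fun j hj hjn => h' j hj (by omega)
    obtain ⟨P, hP, hw⟩ := hE.exists_prederivation hn hext (hcomm h) hf hf3 hc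
    exact ⟨P, hP, hw.bijective hE⟩
  · rintro ⟨D, hbij⟩
    obtain ⟨a, hw⟩ := hE.exists_hasWeights hn D.isPrederivation hbij.1
    have hj := iff₂.1 (hw.exists_dvd_of_derivation hE hn hf hf3)
    exact ⟨⟨hweights _ (D.isPrederivation.smul a) hw, fun j h7 hjn => hj j h7 (by omega)⟩,
      hj n (by omega) (by omega)⟩
  · rintro ⟨⟨h, h'⟩, h''⟩
    obtain ⟨c, hc⟩ := iff₂.2 fun j hj hjn => by
      rcases Nat.lt_or_ge j n with hlt | hge
      · exact h' j hj (by omega)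
      · obtain rfl : j = n := by omega
        exact h''
    obtain ⟨D, hw⟩ := hE.exists_derivation hn hext (hcomm h) hf hf2 hc
    exact ⟨D, hw.bijective hE⟩
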